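/- Let $n\ge 2$ be an integer with $n\ne 5,6,7$. Consider the integral lattices $\Lambda$ (all scalar products $x\cdot y$ with $x,y\in\Lambda$ are integers) of full rank in an $n$-dimensional Euclidean space, of minimum $3$ (that is, $\min_{0\neq x\in\Lambda} x\cdot x=3$), whose set $S(\Lambda)$ of minimal vectors (the vectors $x\in\Lambda$ with $x\cdot x=3$) supports an equiangular family of lines of rank $n$: any two distinct lines among the $\mathbb{R}x$, $x\in S(\Lambda)$, make the same angle $\theta\in[0,\pi/2]$, and $S(\Lambda)$ spans the space over $\mathbb{R}$. Then the maximal number of lines $\frac12|S(\Lambda)|$ for such lattices is $2(n-1)$. Let $D_{n+1}=\{x\in\mathbb{Z}^{n+1} : \sum_i x_i \text{ even}\}$, with $\varepsilon_1,\dots,\varepsilon_{n+1}$ the canonical basis of $\mathbb{R}^{n+1}$, and let $P_n$ be the image of $D_{n+1}$ under orthogonal projection onto the hyperplane $(\varepsilon_1-\varepsilon_2)^\perp$, rescaled by $\sqrt2$. Then $P_n$ is such a lattice, is generated by its minimal vectors, and attains the maximum. If moreover $n\ne 2$, then for every such lattice $\Lambda$ attaining the maximum, the sublattice generated by $S(\Lambda)$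 is isometric to $P_n$; in particular $P_n$ is, up to isometry, the unique such lattice that is generated by its minimal vectors and attains the maximum. -/

import Mathlib

open scoped InnerProductSpace

noncomputable section

namespace EquiLat

section General

variable {E : Type*} [NormedAddCommGroup E] [InnerProductSpace ℝ E]

/-- `Λ` is a full (Euclidean) lattice in `E`: a discrete additive subgroup spanning `E` over `ℝ`. -/
def IsFullLattice (Λ : Submodule ℤ E) : Prop :=
  DiscreteTopology Λ ∧ Submodule.span ℝ (Λ : Set E) = ⊤

/-- Integral lattices: all scalar products are integers. -/
def IsIntegral (Λ : Submodule ℤ E) : Prop :=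
  ∀ x ∈ Λ, ∀ y ∈ Λ, ∃ k : ℤ, ⟪x, y⟫_ℝ = k

/-- The minimum of `Λ` (the least norm `x · x` of a nonzero vector of `Λ`) is `m`. -/
def HasMinimum (Λ : Submodule ℤ E) (m : ℝ) : Prop :=
  IsLeast {r : ℝ | ∃ x ∈ Λ, x ≠ 0 ∧ r = ⟪x, x⟫_ℝ} m

/-- The set `S(Λ)` of minimal vectors of `Λ`. -/
def minimalVectors (Λ : Submodule ℤ E) : Set E :=
  {x | x ∈ Λ ∧ x ≠ 0 ∧ ∀ y ∈ Λ, y ≠ 0 → ⟪x, x⟫_ℝ ≤ ⟪y, y⟫_ℝ}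

/-- The set of lines supported by the minimal vectors of `Λ`. -/
def minimalLines (Λ : Submodule ℤ E) : Set (Submodule ℝ E) :=
  {l | ∃ x ∈ minimalVectors Λ, l = Submodule.span ℝ {x}}

/-- A set of lines is equiangular if any two distinct lines in it make the same
angle `θ ∈ [0, π/2]`. -/
def IsEquiangular (X : Set (Submodule ℝ E)) : Prop :=
  (∀ l ∈ X, Module.finrank ℝ l = 1) ∧
  ∃ θ ∈ Set.Icc (0 : ℝ) (Real.pi / 2), ∀ l ∈ X, ∀ l' ∈ X, l ≠ l' →
    ∀ x ∈ l, ∀ y ∈ l', |⟪x, y⟫_ℝ| = Real.cos θ * (‖x‖ * ‖y‖)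

/-- The rank of a set of lines: the dimension of the space they span. -/
def lineRank (X : Set (Submodule ℝ E)) : ℕ :=
  Module.finrank ℝ (sSup X : Submodule ℝ E)

/-- Integral lattices of minimum 3 in an `n`-dimensional space `E` whose minimal vectors support
an equiangular family of lines of rank `n`. -/
structure IsEquiangularMinThree (n : ℕ) (Λ : Submodule ℤ E) : Prop where
  dim : Module.finrank ℝ E = n
  lattice : IsFullLattice Λ
  integral : IsIntegral Λ
  minimum : HasMinimum Λ 3
  equiangular : IsEquiangular (minimalLines Λ)
  rank : lineRank (minimalLines Λ) = n

/-- The sublattice generated by the minimal vectors. -/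
def minimalSublattice (Λ : Submodule ℤ E) : Submodule ℤ E :=
  Submodule.span ℤ (minimalVectors Λ)

/-- Isometry of lattices living in possibly different Euclidean spaces. -/
def Isometric {F : Type*} [NormedAddCommGroup F] [InnerProductSpace ℝ F]
    (Λ : Submodule ℤ E) (M : Submodule ℤ F) : Prop :=
  ∃ f : E ≃ₗᵢ[ℝ] F, f '' (Λ : Set E) = (M : Set F)

end General

/-- The lattice `D_k` of integral vectors with even coordinate sum in `ℝ^k`. -/
def latticeD (k : ℕ) : Submodule ℤ (EuclideanSpace ℝ (Fin k)) where
  carrier := {x | ∃ z : Fin k → ℤ, (∀ i, x i = z i) ∧ Even (∑ i, z i)}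
  zero_mem' := ⟨0, by simp, by simp⟩
  add_mem' := by
    rintro x y ⟨z, hz, hz'⟩ ⟨w, hw, hw'⟩
    refine ⟨z + w, fun i => by simp [hz i, hw i], ?_⟩
    simpa [Finset.sum_add_distrib] using hz'.add hw'
  smul_mem' := by
    rintro c x ⟨z, hz, hz'⟩
    refine ⟨c • z, fun i => by simp [hz i], ?_⟩
    simpa [← Finset.mul_sum] using hz'.mul_left c

/-- The minimal vector `ε₁ - ε₂` of `D_{n+1}` (for `n ≥ 1`). -/
def rootVector (n : ℕ) : EuclideanSpace ℝ (Fin (n + 1)) :=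
  EuclideanSpace.single 0 1 - EuclideanSpace.single 1 1

/-- The hyperplane of `ℝ^{n+1}` orthogonal to `ε₁ - ε₂`. -/
abbrev rootHyperplane (n : ℕ) : Submodule ℝ (EuclideanSpace ℝ (Fin (n + 1))) :=
  (Submodule.span ℝ {rootVector n})ᗮ

/-- The orthogonal projection of `D_{n+1}` along its minimal vector `ε₁ - ε₂`, rescaled by `√2`
(the projection itself has minimum `3/2`). -/
def projectedD (n : ℕ) : Submodule ℤ (rootHyperplane n) :=
  (latticeD (n + 1)).map
    ((Real.sqrt 2 • (rootHyperplane n).orthogonalProjectionOnto.toLinearMap).restrictScalars ℤ)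

end EquiLat

end

/-!
The minimal vectors of an integral lattice of minimum `3` have products `0` or `±1` unless they
are proportional: `x ± y` has norm `6 ± 2 x · y ≥ 3`. Equiangularity makes these products either
all `0`, and then there are at most `n` lines, or all `±1`. In the second case the set `S` of
minimal vectors is closed under `(x, y, z) ↦ x + y + z` for pairwise products `-1`, because such
a sum has norm `3` again (`IsClosedSystem`).

If no three vectors of `S` have pairwise products `-1`, representatives of the lines can be
oriented to have all products `1`, so they are independent and there are at most `n` lines
(`ncard_lines_le_of_no_triple`). Otherwise let `a`, `b`, `c` be such vectors. The lines of `S`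
other than those of `a`, `b`, `c`, `a + b + c` are generated by vectors of `S` having products
`1`, `1`, `-1` with `a`, `b`, `c` in some order, so they fall into three pillars (`InPillar`).

If at most one pillar, say that of `a` and `b`, is nonempty, then no vector of `S` is orthogonal
to `a + b`, and with `u = (a + b) / 2` one finds `S = {± u ± w i}`, where `u` together with the
`w i` is an orthogonal basis, `u · u = 1` and `w i · w i = 2` (`exists_frame`). The lattice generated
by the `u ± w i` is determined by `n` up to isometry, has `2 (n - 1)` minimal lines, and the
projection of `D_{n+1}` is of this shape (`projectedD_eq_frameLattice`).

If two pillars are nonempty, they contain `z` and `y` with `z · y = -1`. The vectors `a`, `b`, `c`,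
`z`, `y` are independent, so `n ≥ 5`. The sum rule expresses the vectors of all pillars by `a`,
`b`, `c`, `y` and the pillar of `z`. Modulo the span of `a`, `b`, `c`, the lines of that pillar are
orthogonal, and `y` has products `±1` with vectors of norm `2` on them, so by Bessel's inequality
there are at most four of them, and four of them span `y`. Hence `n ≤ 7` (`finrank_of_two_pillars`).

For `n ≠ 5, 6, 7` there are thus at most `n ≤ 2 (n - 1)` lines, or `S` generates a frame lattice;
`n = 2 (n - 1)` holds for `n = 2` only.
-/

noncomputable section

namespace EquiLat

/-! ### Frame lattices -/

section Frame

variable {E F ι κ : Type*} [NormedAddCommGroup E] [InnerProductSpace ℝ E]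
  [NormedAddCommGroup F] [InnerProductSpace ℝ F]

/-- A frame: an orthogonal basis consisting of one vector `u` of norm `u · u = 1` and of vectors
`w i` of norm `w i · w i = 2`. -/
structure IsFrame (u : E) (w : ι → E) : Prop where
  inner_u : ⟪u, u⟫_ℝ = 1
  inner_u_w : ∀ i, ⟪u, w i⟫_ℝ = 0
  inner_w : ∀ i, ⟪w i, w i⟫_ℝ = 2
  inner_w_w : ∀ i j, i ≠ j → ⟪w i, w j⟫_ℝ = 0
  span_eq : Submodule.span ℝ (insert u (Set.range w)) = ⊤

/-- The vectors `u + w i` (indexed by `(i, true)`) and `u - w i` (indexed by `(i, false)`). -/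
def frameVector (u : E) (w : ι → E) (p : ι × Bool) : E :=
  if p.2 then u + w p.1 else u - w p.1

/-- The lattice generated by the vectors `u ± w i`. -/
def frameLattice (u : E) (w : ι → E) : Submodule ℤ E :=
  Submodule.span ℤ (Set.range (frameVector u w))

lemma frameLattice_map (f : E →ₗ[ℝ] F) (u : E) (w : ι → E) :
    (frameLattice u w).map (f.restrictScalars ℤ) = frameLattice (f u) (f ∘ w) := by
  rw [frameLattice, Submodule.map_span, ← Set.range_comp, frameLattice]
  congr 2
  ext ⟨i, b⟩
  cases b <;> simp [frameVector]

omit [InnerProductSpace ℝ E] in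
lemma frameVector_mem (u : E) (w : ι → E) (p : ι × Bool) :
    frameVector u w p ∈ frameLattice u w :=
  Submodule.subset_span ⟨p, rfl⟩

omit [InnerProductSpace ℝ E] in
lemma frameLattice_comp_equiv (u : E) (w : ι → E) (e : κ ≃ ι) :
    frameLattice u (w ∘ e) = frameLattice u w := by
  have : frameVector u (w ∘ e) = frameVector u w ∘ (e.prodCongr (Equiv.refl Bool)) := by
    ext ⟨i, b⟩
    cases b <;> simp [frameVector]
  rw [frameLattice, frameLattice, this, EquivLike.range_comp]

lemma mem_frameLattice [Fintype ι] [Nonempty ι] (u : E) (w : ι → E) (x : E) :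
    x ∈ frameLattice u w ↔ ∃ (s : ℤ) (z : ι → ℤ), Even (s - ∑ i, z i) ∧
      x = (s : ℝ) • u + ∑ i, (z i : ℝ) • w i := by
  classical
  constructor
  · intro hx
    induction hx using Submodule.span_induction with
    | mem x hx =>
      obtain ⟨⟨i, b⟩, rfl⟩ := hx
      cases b
      · exact ⟨1, Pi.single i (-1), by simp, by
          simp [frameVector, Pi.single_apply, apply_ite (Int.cast : ℤ → ℝ), ite_smul,
            sub_eq_add_neg]⟩
      · exact ⟨1, Pi.single i 1, by simp, by
          simp [frameVector, Pi.single_apply, apply_ite (Int.cast : ℤ → ℝ), ite_smul]⟩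
    | zero => exact ⟨0, 0, by simp, by simp⟩
    | add x y _ _ hx hy =>
      obtain ⟨s, z, h, rfl⟩ := hx
      obtain ⟨s', z', h', rfl⟩ := hy
      refine ⟨s + s', z + z', ?_, ?_⟩
      · have := h.add h'
        simp only [Pi.add_apply, Finset.sum_add_distrib]
        rwa [show s + s' - (∑ i, z i + ∑ i, z' i) = s - ∑ i, z i + (s' - ∑ i, z' i) by ring]
      · simp only [Pi.add_apply, Int.cast_add, add_smul, Finset.sum_add_distrib]
        abel
    | smul c x _ hx =>
      obtain ⟨s, z, h, rfl⟩ := hx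
      refine ⟨c * s, fun i => c * z i, ?_, ?_⟩
      · rw [← Finset.mul_sum, ← mul_sub]
        exact h.mul_left c
      · simp only [Int.cast_mul, mul_smul, ← Finset.smul_sum, ← smul_add]
        rw [← Int.cast_smul_eq_zsmul ℝ]
  · rintro ⟨s, z, ⟨k, hk⟩, rfl⟩
    -- `s u + ∑ zᵢ wᵢ = ∑ zᵢ (u + wᵢ) + (s - ∑ zᵢ) u`, where `2 u = (u + w j) + (u - w j)`
    obtain ⟨j⟩ := ‹Nonempty ι›
    have key : (s : ℝ) • u + ∑ i, (z i : ℝ) • w i =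
        ∑ i, z i • frameVector u w (i, true) +
          k • (frameVector u w (j, true) + frameVector u w (j, false)) := by
      have hs : (s : ℝ) = ∑ i, (z i : ℝ) + (k + k) := by
        have : s = ∑ i, z i + (k + k) := by omega
        exact_mod_cast congrArg (Int.cast : ℤ → ℝ) this
      simp only [frameVector, if_true, Bool.false_eq_true, if_false]
      simp only [← Int.cast_smul_eq_zsmul ℝ, smul_add, smul_sub, Finset.sum_add_distrib,
        ← Finset.sum_smul, hs, add_smul]
      abel
    rw [key]
    exact add_mem (sum_mem fun i _ => Submodule.smul_mem _ _ (frameVector_mem u w _))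
      (Submodule.smul_mem _ _ (add_mem (frameVector_mem u w _) (frameVector_mem u w _)))

namespace IsFrame

variable {u : E} {w : ι → E} (h : IsFrame u w)
include h

lemma inner_w_u (i : ι) : ⟪w i, u⟫_ℝ = 0 := by
  rw [real_inner_comm, h.inner_u_w]

lemma comp_equiv (e : κ ≃ ι) : IsFrame u (w ∘ e) where
  inner_u := h.inner_u
  inner_u_w i := h.inner_u_w _
  inner_w i := h.inner_w _
  inner_w_w i j hij := h.inner_w_w _ _ (e.injective.ne hij)
  span_eq := by rw [EquivLike.range_comp]; exact h.span_eq

lemma inner_coords [Fintype ι] (s s' : ℝ) (z z' : ι → ℝ) :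
    ⟪s • u + ∑ i, z i • w i, s' • u + ∑ i, z' i • w i⟫_ℝ = s * s' + 2 * ∑ i, z i * z' i := by
  classical
  have h2 : ∀ i, ⟪w i, ∑ j, z' j • w j⟫_ℝ = 2 * z' i := by
    intro i
    rw [inner_sum, Finset.sum_eq_single i]
    · rw [inner_smul_right, h.inner_w]; ring
    · intro j _ hj
      rw [inner_smul_right, h.inner_w_w i j hj.symm, mul_zero]
    · simp
  have h3 : ⟪u, ∑ j, z' j • w j⟫_ℝ = 0 := by
    simp [inner_sum, inner_smul_right, h.inner_u_w]
  have h4 : ⟪∑ j, z j • w j, u⟫_ℝ = 0 := by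
    simp [sum_inner, inner_smul_left, h.inner_w_u]
  have h5 : ⟪∑ j, z j • w j, ∑ j, z' j • w j⟫_ℝ = 2 * ∑ i, z i * z' i := by
    rw [sum_inner, Finset.mul_sum]
    refine Finset.sum_congr rfl fun i _ => ?_
    rw [real_inner_smul_left, h2]
    ring
  rw [inner_add_left, inner_add_right, inner_add_right, h5, real_inner_smul_left,
    real_inner_smul_left, real_inner_smul_right, real_inner_smul_right, h.inner_u, h3, h4]
  ring

/-- The orthonormal basis obtained from a frame by normalization. -/
def orthonormalBasis [Fintype ι] : OrthonormalBasis (Option ι) ℝ E :=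
  OrthonormalBasis.mk (v := fun o : Option ι => o.elim u fun i => (√2)⁻¹ • w i)
    (by
      classical
      have h2 : (√2)⁻¹ * ((√2)⁻¹ * (2 : ℝ)) = 1 := by
        have : √2 * √2 = (2 : ℝ) := Real.mul_self_sqrt (by norm_num)
        field_simp
        nlinarith
      rw [orthonormal_iff_ite]
      rintro (_ | i) (_ | j)
      · simpa using h.inner_u
      · simp [inner_smul_right, h.inner_u_w]
      · simp [inner_smul_left, h.inner_w_u]
      · simp only [Option.elim, inner_smul_left, inner_smul_right, Option.some.injEq]
        by_cases hij : i = j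
        · subst hij
          rw [h.inner_w, if_pos rfl]
          simpa using h2
        · simp [hij, h.inner_w_w _ _ hij])
    (by
      rw [← h.span_eq, Submodule.span_le]
      rintro x (rfl | ⟨i, rfl⟩)
      · exact Submodule.subset_span ⟨none, rfl⟩
      · have : w i = √2 • ((√2)⁻¹ • w i) := by
          rw [smul_smul, mul_inv_cancel₀ (by positivity), one_smul]
        rw [this]
        exact Submodule.smul_mem _ _ (Submodule.subset_span ⟨some i, rfl⟩))

lemma orthonormalBasis_none [Fintype ι] : h.orthonormalBasis none = u := by
  simp [orthonormalBasis]

lemma orthonormalBasis_some [Fintype ι] (i : ι) :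
    √2 • h.orthonormalBasis (some i) = w i := by
  simp [orthonormalBasis, smul_smul]

lemma finrank_eq [Fintype ι] : Module.finrank ℝ E = Fintype.card ι + 1 := by
  rw [Module.finrank_eq_card_basis h.orthonormalBasis.toBasis, Fintype.card_option]

/-- The lattices of any two frames of the same size are isometric. -/
lemma isometric [Fintype ι] [Fintype κ] {u' : F} {w' : κ → F} (h' : IsFrame u' w')
    (e : ι ≃ κ) : Isometric (frameLattice u w) (frameLattice u' w') := by
  let f := h.orthonormalBasis.equiv h'.orthonormalBasis (Equiv.optionCongr e)
  have hu : f u = u' := by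
    rw [← h.orthonormalBasis_none, OrthonormalBasis.equiv_apply_basis]
    exact h'.orthonormalBasis_none
  have hw : ∀ i, f (w i) = w' (e i) := by
    intro i
    rw [← h.orthonormalBasis_some, map_smul, OrthonormalBasis.equiv_apply_basis]
    exact h'.orthonormalBasis_some _
  refine ⟨f, ?_⟩
  have := frameLattice_map f.toLinearEquiv.toLinearMap u w
  have hw' : (f.toLinearEquiv.toLinearMap : E → F) ∘ w = w' ∘ e := funext hw
  rw [hw', frameLattice_comp_equiv] at this
  rw [show u' = f.toLinearEquiv.toLinearMap u from hu.symm, ← this]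
  rfl

lemma inner_frameVector_self (p : ι × Bool) :
    ⟪frameVector u w p, frameVector u w p⟫_ℝ = 3 := by
  obtain ⟨i, b⟩ := p
  cases b <;> simp only [frameVector, if_true, Bool.false_eq_true, if_false, inner_add_left,
    inner_add_right, inner_sub_left, inner_sub_right, h.inner_u, h.inner_u_w, h.inner_w_u,
    h.inner_w] <;> norm_num

lemma abs_inner_frameVector {p q : ι × Bool} (hpq : p ≠ q) :
    |⟪frameVector u w p, frameVector u w q⟫_ℝ| = 1 := by
  obtain ⟨i, b⟩ := p
  obtain ⟨j, c⟩ := q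
  by_cases hij : i = j
  · subst hij
    cases b <;> cases c <;> first
      | exact absurd rfl hpq
      | simp only [frameVector, if_true, Bool.false_eq_true, if_false, inner_add_left,
          inner_add_right, inner_sub_left, inner_sub_right, h.inner_u, h.inner_u_w, h.inner_w_u,
          h.inner_w]
        norm_num
  · cases b <;> cases c <;> simp only [frameVector, if_true, Bool.false_eq_true, if_false,
      inner_add_left, inner_add_right, inner_sub_left, inner_sub_right, h.inner_u, h.inner_u_w,
      h.inner_w_u, h.inner_w_w i j hij] <;> norm_num

lemma frameVector_ne_zero (p : ι × Bool) : frameVector u w p ≠ 0 := by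
  intro h0
  have := h.inner_frameVector_self p
  simp [h0] at this

/-- The nonzero vectors of a frame lattice have norm at least `3`, with equality only for the
vectors `± u ± w i`: the norm is `s² + 2q` with `q = ∑ zᵢ²` congruent to `s` modulo `2`. -/
lemma three_le_inner [Fintype ι] [Nonempty ι] {x : E} (hx : x ∈ frameLattice u w) (hx0 : x ≠ 0) :
    3 ≤ ⟪x, x⟫_ℝ ∧ (⟪x, x⟫_ℝ = 3 → ∃ p, x = frameVector u w p ∨ x = -frameVector u w p) := by
  classical
  obtain ⟨s, z, hs, rfl⟩ := (mem_frameLattice u w x).1 hx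
  rw [h.inner_coords]
  have hq0 : 0 ≤ ∑ i, z i * z i := Finset.sum_nonneg fun i _ => mul_self_nonneg _
  have hpar : Even (s - ∑ i, z i * z i) := by
    have : Even (∑ i, (z i * z i - z i)) := by
      refine Finset.even_sum _ fun i _ => ?_
      have := Int.even_mul_pred_self (z i)
      rwa [mul_sub, mul_one] at this
    rw [Finset.sum_sub_distrib] at this
    have h2 := hs.sub this
    rwa [show s - ∑ i, z i * z i = s - ∑ i, z i - (∑ i, z i * z i - ∑ i, z i) by ring]
  have hcast : (s : ℝ) * s + 2 * ∑ i, (z i : ℝ) * z i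
      = ((s * s + 2 * ∑ i, z i * z i : ℤ) : ℝ) := by push_cast; rfl
  rw [hcast]
  have hz1 : ∀ i, z i ≠ 0 → 1 ≤ z i * z i := fun i hi => by
    have := mul_self_pos.2 hi
    omega
  have hzq : ∀ i, z i * z i ≤ ∑ i, z i * z i := fun i =>
    Finset.single_le_sum (f := fun i => z i * z i) (fun i _ => mul_self_nonneg _)
      (Finset.mem_univ i)
  have hmain : 3 ≤ s * s + 2 * ∑ i, z i * z i ∧
      (s * s + 2 * ∑ i, z i * z i = 3 → s * s = 1 ∧ ∑ i, z i * z i = 1) := by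
    rcases (show ∑ i, z i * z i = 0 ∨ ∑ i, z i * z i = 1 ∨ 2 ≤ ∑ i, z i * z i by omega)
      with hq | hq | hq
    · have hz : ∀ i, z i = 0 := fun i => by
        by_contra hi
        have := hz1 i hi
        have := hzq i
        omega
      have hs0 : s ≠ 0 := by
        rintro rfl
        apply hx0
        simp [hz]
      rw [hq] at hpar ⊢
      obtain ⟨k, hk⟩ := hpar
      have : s = 2 * k := by omega
      have hk0 : k ≠ 0 := by rintro rfl; omega
      have := mul_self_pos.2 hk0
      subst s
      constructor
      · nlinarith
      · intro h3; nlinarith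
    · rw [hq] at hpar ⊢
      have hs0 : s ≠ 0 := by
        rintro rfl
        norm_num at hpar
      have := mul_self_pos.2 hs0
      refine ⟨by omega, fun h3 => ⟨by omega, rfl⟩⟩
    · have := mul_self_nonneg s
      refine ⟨by omega, fun h3 => by omega⟩
  refine ⟨by exact_mod_cast hmain.1, fun h3 => ?_⟩
  obtain ⟨hs1, hq1⟩ := hmain.2 (by exact_mod_cast h3)
  obtain ⟨i, hi⟩ : ∃ i, z i ≠ 0 := by
    by_contra! hz
    simp [hz] at hq1
  have hsum := Finset.add_sum_erase Finset.univ (fun i => z i * z i) (Finset.mem_univ i)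
  have herase : ∀ j, j ≠ i → z j = 0 := by
    intro j hj
    by_contra hj0
    have h1 := Finset.single_le_sum (s := Finset.univ.erase i) (f := fun i => z i * z i)
      (fun i _ => mul_self_nonneg _) (Finset.mem_erase.2 ⟨hj, Finset.mem_univ j⟩)
    have h2 := hz1 j hj0
    have h3 := hz1 i hi
    omega
  have hzi : z i * z i = 1 := by
    have := hz1 i hi
    have := hzq i
    omega
  have hsumw : ∑ j, (z j : ℝ) • w j = (z i : ℝ) • w i := by
    refine Finset.sum_eq_single i (fun j _ hj => ?_) (by simp)
    simp [herase j hj]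
  rw [hsumw]
  rcases mul_self_eq_one_iff.1 hs1 with hs | hs <;>
    rcases mul_self_eq_one_iff.1 hzi with hz | hz <;> rw [hs, hz]
  · exact ⟨(i, true), Or.inl (by simp [frameVector])⟩
  · exact ⟨(i, false), Or.inl (by simp [frameVector, sub_eq_add_neg])⟩
  · exact ⟨(i, false), Or.inr (by simp [frameVector]; abel)⟩
  · exact ⟨(i, true), Or.inr (by simp [frameVector]; abel)⟩

lemma hasMinimum [Fintype ι] [Nonempty ι] : HasMinimum (frameLattice u w) 3 := by
  obtain ⟨i⟩ := ‹Nonempty ι›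
  refine ⟨⟨frameVector u w (i, true), frameVector_mem u w _, h.frameVector_ne_zero _,
    (h.inner_frameVector_self _).symm⟩, ?_⟩
  rintro r ⟨x, hx, hx0, rfl⟩
  have : Nonempty ι := ⟨i⟩
  exact (h.three_le_inner hx hx0).1

lemma mem_minimalVectors_iff [Fintype ι] [Nonempty ι] (x : E) :
    x ∈ minimalVectors (frameLattice u w) ↔
      ∃ p, x = frameVector u w p ∨ x = -frameVector u w p := by
  constructor
  · rintro ⟨hx, hx0, hmin⟩
    obtain ⟨i⟩ := ‹Nonempty ι›
    have : Nonempty ι := ⟨i⟩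
    have h1 := hmin _ (frameVector_mem u w (i, true)) (h.frameVector_ne_zero _)
    rw [h.inner_frameVector_self] at h1
    have h2 := h.three_le_inner hx hx0
    exact h2.2 (le_antisymm h1 h2.1)
  · rintro ⟨p, rfl | rfl⟩
    · refine ⟨frameVector_mem u w _, h.frameVector_ne_zero _, fun y hy hy0 => ?_⟩
      rw [h.inner_frameVector_self]
      exact (h.three_le_inner hy hy0).1
    · refine ⟨neg_mem (frameVector_mem u w _), neg_ne_zero.2 (h.frameVector_ne_zero _),
        fun y hy hy0 => ?_⟩
      rw [inner_neg_neg, h.inner_frameVector_self]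
      exact (h.three_le_inner hy hy0).1

lemma minimalSublattice_eq [Fintype ι] [Nonempty ι] :
    minimalSublattice (frameLattice u w) = frameLattice u w := by
  apply le_antisymm
  · exact Submodule.span_le.2 fun x hx => hx.1
  · rw [frameLattice, Submodule.span_le]
    rintro _ ⟨p, rfl⟩
    exact Submodule.subset_span ((h.mem_minimalVectors_iff _).2 ⟨p, Or.inl rfl⟩)

lemma minimalLines_eq [Fintype ι] [Nonempty ι] :
    minimalLines (frameLattice u w) =
      Set.range fun p => Submodule.span ℝ {frameVector u w p} := by
  ext l
  constructor
  · rintro ⟨x, hx, rfl⟩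
    obtain ⟨p, rfl | rfl⟩ := (h.mem_minimalVectors_iff x).1 hx
    · exact ⟨p, rfl⟩
    · exact ⟨p, by rw [← Set.neg_singleton, Submodule.span_neg]⟩
  · rintro ⟨p, rfl⟩
    exact ⟨_, (h.mem_minimalVectors_iff _).2 ⟨p, Or.inl rfl⟩, rfl⟩

lemma ncard_minimalLines [Fintype ι] [Nonempty ι] :
    (minimalLines (frameLattice u w)).ncard = 2 * Fintype.card ι := by
  rw [h.minimalLines_eq, Set.ncard_range_of_injective]
  · simp [mul_comm]
  · intro p q hpq
    by_contra hne
    have hp : frameVector u w p ∈ Submodule.span ℝ {frameVector u w q} := by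
      rw [← show Submodule.span ℝ {frameVector u w p} = Submodule.span ℝ {frameVector u w q}
        from hpq]
      exact Submodule.mem_span_singleton_self _
    obtain ⟨c, hc⟩ := Submodule.mem_span_singleton.1 hp
    -- `p = c q` would give `|c| = 1 / 3` and `c² = 1`
    have h1 := h.abs_inner_frameVector hne
    have h2 := h.inner_frameVector_self p
    rw [← hc, real_inner_smul_left, h.inner_frameVector_self, abs_mul] at h1
    rw [← hc, real_inner_smul_left, real_inner_smul_right, h.inner_frameVector_self] at h2
    have h3 : |c| * |c| = 1 := by rw [abs_mul_abs_self]; linarith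
    norm_num at h1
    have h4 : |c| = 1 / 3 := by linarith
    rw [h4] at h3
    norm_num at h3

lemma isEquiangular [Fintype ι] [Nonempty ι] :
    IsEquiangular (minimalLines (frameLattice u w)) := by
  rw [h.minimalLines_eq]
  have hnorm : ∀ p, ‖frameVector u w p‖ * ‖frameVector u w p‖ = 3 := fun p => by
    rw [← real_inner_self_eq_norm_mul_norm, h.inner_frameVector_self]
  have hnorm' : ∀ p, ‖frameVector u w p‖ = √3 := fun p => by
    rw [← hnorm p, Real.sqrt_mul_self (norm_nonneg _)]
  refine ⟨?_, Real.arccos (1 / 3), ⟨Real.arccos_nonneg _,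
    Real.arccos_le_pi_div_two.2 (by norm_num)⟩, ?_⟩
  · rintro _ ⟨p, rfl⟩
    exact finrank_span_singleton (h.frameVector_ne_zero p)
  · rintro _ ⟨p, rfl⟩ _ ⟨q, rfl⟩ hne x hx y hy
    obtain ⟨a, rfl⟩ := Submodule.mem_span_singleton.1 hx
    obtain ⟨b, rfl⟩ := Submodule.mem_span_singleton.1 hy
    have hpq : p ≠ q := by rintro rfl; exact hne rfl
    rw [real_inner_smul_left, real_inner_smul_right, abs_mul, abs_mul, h.abs_inner_frameVector hpq,
      Real.cos_arccos (by norm_num) (by norm_num), norm_smul, norm_smul, hnorm', hnorm',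
      Real.norm_eq_abs, Real.norm_eq_abs]
    have : √3 * √3 = (3 : ℝ) := Real.mul_self_sqrt (by norm_num)
    linear_combination (-(1 / 3) * |a| * |b|) * this

lemma span_frameVector [Nonempty ι] :
    Submodule.span ℝ (Set.range (frameVector u w)) = ⊤ := by
  obtain ⟨i₀⟩ := ‹Nonempty ι›
  have hp : ∀ p, frameVector u w p ∈ Submodule.span ℝ (Set.range (frameVector u w)) :=
    fun p => Submodule.subset_span ⟨p, rfl⟩
  rw [eq_top_iff, ← h.span_eq, Submodule.span_le]
  rintro x (hx | ⟨i, rfl⟩)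
  · rw [hx]
    have hu : u = (1 / 2 : ℝ) • (frameVector u w (i₀, true) + frameVector u w (i₀, false)) := by
      simp only [frameVector, if_true, Bool.false_eq_true, if_false]
      module
    have h2 := Submodule.smul_mem _ (1 / 2 : ℝ) (add_mem (hp (i₀, true)) (hp (i₀, false)))
    rwa [← hu] at h2
  · have : w i = (1 / 2 : ℝ) • (frameVector u w (i, true) - frameVector u w (i, false)) := by
      simp only [frameVector, if_true, Bool.false_eq_true, if_false]
      module
    rw [this]
    exact Submodule.smul_mem _ _ (sub_mem (hp _) (hp _))

lemma isFullLattice [Fintype ι] [Nonempty ι] : IsFullLattice (frameLattice u w) := by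
  constructor
  · refine DiscreteTopology.of_forall_le_dist (r := 1) one_pos fun x y hxy => ?_
    have hne : (x : E) - y ≠ 0 := sub_ne_zero.2 fun hxy' => hxy (Subtype.ext hxy')
    have h3 := (h.three_le_inner (sub_mem x.2 y.2) hne).1
    rw [real_inner_self_eq_norm_mul_norm] at h3
    simp only [Subtype.dist_eq]
    rw [dist_eq_norm]
    nlinarith [norm_nonneg ((x : E) - y)]
  · rw [eq_top_iff, ← h.span_frameVector]
    exact Submodule.span_mono (Set.range_subset_iff.2 (frameVector_mem u w))

lemma isIntegral [Fintype ι] [Nonempty ι] : IsIntegral (frameLattice u w) := by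
  intro x hx y hy
  obtain ⟨s, z, -, rfl⟩ := (mem_frameLattice u w x).1 hx
  obtain ⟨s', z', -, rfl⟩ := (mem_frameLattice u w y).1 hy
  refine ⟨s * s' + 2 * ∑ i, z i * z' i, ?_⟩
  rw [h.inner_coords]
  push_cast
  rfl

theorem isEquiangularMinThree [Fintype ι] [Nonempty ι] :
    IsEquiangularMinThree (Fintype.card ι + 1) (frameLattice u w) where
  dim := h.finrank_eq
  lattice := h.isFullLattice
  integral := h.isIntegral
  minimum := h.hasMinimum
  equiangular := h.isEquiangular
  rank := by
    have : sSup (minimalLines (frameLattice u w)) = ⊤ := by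
      rw [eq_top_iff, ← h.span_frameVector, Submodule.span_le]
      rintro _ ⟨p, rfl⟩
      refine (le_sSup (a := Submodule.span ℝ {frameVector u w p}) ?_)
        (Submodule.mem_span_singleton_self _)
      rw [h.minimalLines_eq]
      exact ⟨p, rfl⟩
    rw [lineRank, this, finrank_top, h.finrank_eq]

end IsFrame

lemma exists_isFrame (m : ℕ) (hE : Module.finrank ℝ E = m + 1) :
    ∃ (u : E) (w : Fin m → E), IsFrame u w := by
  have : FiniteDimensional ℝ E := Module.finite_of_finrank_pos (by omega)
  let b := (stdOrthonormalBasis ℝ E).reindex (finCongr hE)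
  have hb := orthonormal_iff_ite.1 b.orthonormal
  have h2 : √2 * √2 = (2 : ℝ) := Real.mul_self_sqrt (by norm_num)
  refine ⟨b 0, fun i => √2 • b i.succ, by rw [hb, if_pos rfl], fun i => ?_, fun i => ?_,
    fun i j hij => ?_, ?_⟩
  · rw [inner_smul_right, hb, if_neg (Fin.succ_ne_zero i).symm, mul_zero]
  · rw [inner_smul_right, real_inner_smul_left, hb, if_pos rfl, mul_one, h2]
  · rw [inner_smul_right, real_inner_smul_left, hb, if_neg (by simpa using hij)]
    ring
  · rw [eq_top_iff, ← b.toBasis.span_eq, Submodule.span_le]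
    rintro _ ⟨i, rfl⟩
    rw [SetLike.mem_coe, OrthonormalBasis.coe_toBasis]
    refine Fin.cases ?_ (fun i => ?_) i
    · exact Submodule.subset_span (Set.mem_insert _ _)
    · have : b i.succ = (√2)⁻¹ • (√2 • b i.succ) := by
        rw [smul_smul, inv_mul_cancel₀ (by positivity), one_smul]
      rw [this]
      exact Submodule.smul_mem _ _ (Submodule.subset_span (Set.mem_insert_of_mem _ ⟨i, rfl⟩))

end Frame

/-! ### The projection of `D_{n+1}` as a frame lattice -/

section ProjectedD

lemma inner_rootVector (m : ℕ) (x : EuclideanSpace ℝ (Fin (m + 2))) :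
    ⟪rootVector (m + 1), x⟫_ℝ = x 0 - x 1 := by
  simp [rootVector, inner_sub_left, EuclideanSpace.inner_single_left]

lemma mem_rootHyperplane (m : ℕ) (x : EuclideanSpace ℝ (Fin (m + 2))) :
    x ∈ rootHyperplane (m + 1) ↔ x 0 = x 1 := by
  rw [rootHyperplane, Submodule.mem_orthogonal_singleton_iff_inner_right, inner_rootVector,
    sub_eq_zero]

lemma starProjection_rootHyperplane (m : ℕ) (x : EuclideanSpace ℝ (Fin (m + 2))) :
    (rootHyperplane (m + 1)).starProjection x = x - ((x 0 - x 1) / 2) • rootVector (m + 1) := by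
  apply Submodule.eq_starProjection_of_mem_of_inner_eq_zero
  · rw [mem_rootHyperplane]
    simp [rootVector]
    ring
  · intro w hw
    rw [mem_rootHyperplane] at hw
    rw [sub_sub_cancel, real_inner_smul_left, inner_rootVector, hw]
    ring

/-- The projection of `√2 ε₁`, which is also that of `√2 ε₂`. -/
def projectedU (m : ℕ) : rootHyperplane (m + 1) :=
  ⟨(√2 / 2) • (EuclideanSpace.single 0 1 + EuclideanSpace.single 1 1),
    by simp [mem_rootHyperplane]⟩

/-- The vectors `√2 ε_i` for `i ≥ 3`. -/
def projectedW (m : ℕ) (i : Fin m) : rootHyperplane (m + 1) :=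
  ⟨√2 • EuclideanSpace.single i.succ.succ 1, by
    simp [mem_rootHyperplane, Fin.ext_iff]⟩

lemma coords_projectedU (m : ℕ) :
    (projectedU m : EuclideanSpace ℝ (Fin (m + 2))) 0 = √2 / 2 ∧
    (projectedU m : EuclideanSpace ℝ (Fin (m + 2))) 1 = √2 / 2 ∧
    ∀ i : Fin m, (projectedU m : EuclideanSpace ℝ (Fin (m + 2))) i.succ.succ = 0 := by
  refine ⟨by simp [projectedU], by simp [projectedU], fun i => ?_⟩
  simp [projectedU, Fin.ext_iff]

lemma coords_projectedW (m : ℕ) (i : Fin m) :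
    (projectedW m i : EuclideanSpace ℝ (Fin (m + 2))) 0 = 0 ∧
    (projectedW m i : EuclideanSpace ℝ (Fin (m + 2))) 1 = 0 ∧
    ∀ j : Fin m, (projectedW m i : EuclideanSpace ℝ (Fin (m + 2))) j.succ.succ
      = if j = i then √2 else 0 := by
  refine ⟨by simp [projectedW, Fin.ext_iff], by simp [projectedW, Fin.ext_iff], fun j => ?_⟩
  simp [projectedW]

lemma coords_combination (m : ℕ) (s : ℝ) (z : Fin m → ℝ) :
    ((s • projectedU m + ∑ i, z i • projectedW m i : rootHyperplane (m + 1)) :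
      EuclideanSpace ℝ (Fin (m + 2))) 0 = s * (√2 / 2) ∧
    ((s • projectedU m + ∑ i, z i • projectedW m i : rootHyperplane (m + 1)) :
      EuclideanSpace ℝ (Fin (m + 2))) 1 = s * (√2 / 2) ∧
    ∀ j : Fin m, ((s • projectedU m + ∑ i, z i • projectedW m i : rootHyperplane (m + 1)) :
      EuclideanSpace ℝ (Fin (m + 2))) j.succ.succ = z j * √2 := by
  obtain ⟨h0, h1, h2⟩ := coords_projectedU m
  refine ⟨?_, ?_, fun j => ?_⟩
  · simp [h0, fun i => (coords_projectedW m i).1]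
  · simp [h1, fun i => (coords_projectedW m i).2.1]
  · simp [h2, fun i => (coords_projectedW m i).2.2]

lemma isFrame_projected (m : ℕ) : IsFrame (projectedU m) (projectedW m) := by
  have h2 : √2 * √2 = (2 : ℝ) := Real.mul_self_sqrt (by norm_num)
  obtain ⟨hu0, hu1, hu2⟩ := coords_projectedU m
  have hw := coords_projectedW m
  have hinner : ∀ x y : rootHyperplane (m + 1), ⟪x, y⟫_ℝ =
      (x : EuclideanSpace ℝ (Fin (m + 2))) 0 * (y : EuclideanSpace ℝ (Fin (m + 2))) 0 +
      ((x : EuclideanSpace ℝ (Fin (m + 2))) 1 * (y : EuclideanSpace ℝ (Fin (m + 2))) 1 +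
        ∑ i : Fin m, (x : EuclideanSpace ℝ (Fin (m + 2))) i.succ.succ *
          (y : EuclideanSpace ℝ (Fin (m + 2))) i.succ.succ) := by
    intro x y
    rw [Submodule.coe_inner, PiLp.inner_apply, Fin.sum_univ_succ, Fin.sum_univ_succ]
    simp [mul_comm]
  refine ⟨?_, fun i => ?_, fun i => ?_, fun i j hij => ?_, ?_⟩
  · rw [hinner, hu0, hu1]
    simp only [hu2]
    simp
    linarith
  · rw [hinner, (hw i).1, (hw i).2.1]
    simp [hu2]
  · rw [hinner, (hw i).1, (hw i).2.1]
    simp [(hw i).2.2]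
  · rw [hinner, (hw i).1, (hw i).2.1]
    simp [(hw i).2.2, (hw j).2.2, hij.symm]
  · rw [eq_top_iff]
    intro x _
    have hx : x = ((x : EuclideanSpace ℝ (Fin (m + 2))) 0 * √2) • projectedU m +
        ∑ i : Fin m, ((x : EuclideanSpace ℝ (Fin (m + 2))) i.succ.succ / √2) •
          projectedW m i := by
      obtain ⟨h0, h1, h3⟩ := coords_combination m
        ((x : EuclideanSpace ℝ (Fin (m + 2))) 0 * √2)
        (fun i => (x : EuclideanSpace ℝ (Fin (m + 2))) i.succ.succ / √2)
      have hx01 := (mem_rootHyperplane m x).1 x.2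
      ext k
      refine Fin.cases ?_ (fun k => Fin.cases ?_ (fun k => ?_) k) k
      · rw [h0]
        linear_combination (-(x : EuclideanSpace ℝ (Fin (m + 2))) 0 / 2) * h2
      · rw [show (Fin.succ 0 : Fin (m + 2)) = 1 from rfl, h1, ← hx01]
        linear_combination (-(x : EuclideanSpace ℝ (Fin (m + 2))) 0 / 2) * h2
      · rw [h3, div_mul_cancel₀ _ (by positivity)]
    rw [hx]
    refine add_mem (Submodule.smul_mem _ _ (Submodule.subset_span (Set.mem_insert _ _)))
      (sum_mem fun i _ => Submodule.smul_mem _ _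
        (Submodule.subset_span (Set.mem_insert_of_mem _ ⟨i, rfl⟩)))

/-- An integral vector `z` is projected to `(z₁ + z₂) u + ∑_{i ≥ 3} zᵢ wᵢ` after rescaling. -/
lemma sqrt_smul_projection (m : ℕ) (z : Fin (m + 2) → ℤ) (x : EuclideanSpace ℝ (Fin (m + 2)))
    (hz : ∀ i, x i = z i) :
    √2 • (rootHyperplane (m + 1)).orthogonalProjectionOnto x =
      ((z 0 + z 1 : ℤ) : ℝ) • projectedU m +
        ∑ i : Fin m, (z i.succ.succ : ℝ) • projectedW m i := by
  obtain ⟨h0, h1, h3⟩ := coords_combination m ((z 0 + z 1 : ℤ) : ℝ)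
    (fun i => (z i.succ.succ : ℝ))
  ext k
  rw [Submodule.coe_smul, Submodule.coe_orthogonalProjectionOnto_apply,
    starProjection_rootHyperplane]
  refine Fin.cases ?_ (fun k => Fin.cases ?_ (fun k => ?_) k) k
  · rw [h0]
    simp [rootVector, hz]
    ring
  · rw [show (Fin.succ 0 : Fin (m + 2)) = 1 from rfl, h1]
    simp [rootVector, hz]
    ring
  · rw [h3]
    simp [rootVector, hz, Fin.ext_iff]
    ring

lemma projectedD_eq_frameLattice (m : ℕ) [Nonempty (Fin m)] :
    projectedD (m + 1) = frameLattice (projectedU m) (projectedW m) := by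
  ext x
  rw [mem_frameLattice, projectedD, Submodule.mem_map]
  constructor
  · rintro ⟨y, ⟨z, hz, hev⟩, rfl⟩
    refine ⟨z 0 + z 1, fun i => z i.succ.succ, ?_, sqrt_smul_projection m z y hz⟩
    rw [Fin.sum_univ_succ, Fin.sum_univ_succ] at hev
    have := hev.sub (even_two_mul (∑ i : Fin m, z i.succ.succ))
    rwa [show z 0 + (z (Fin.succ 0) + ∑ i : Fin m, z i.succ.succ) -
      2 * ∑ i : Fin m, z i.succ.succ = z 0 + z 1 - ∑ i : Fin m, z i.succ.succ by
        rw [show (Fin.succ 0 : Fin (m + 2)) = 1 from rfl]; ring] at this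
  · rintro ⟨s, z, hev, rfl⟩
    let z' : Fin (m + 2) → ℤ := Fin.cons s (Fin.cons 0 z)
    refine ⟨WithLp.toLp 2 fun i => (z' i : ℝ), ⟨z', fun i => rfl, ?_⟩, ?_⟩
    · rw [Fin.sum_univ_succ, Fin.sum_univ_succ]
      simp only [z', Fin.cons_zero, Fin.cons_succ]
      have := hev.add (even_two_mul (∑ i : Fin m, z i))
      rwa [show s - ∑ i, z i + 2 * ∑ i, z i = s + (0 + ∑ i, z i) by ring] at this
    · have := sqrt_smul_projection m z' (WithLp.toLp 2 fun i => (z' i : ℝ)) fun i => rfl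
      simp only [z', Fin.cons_zero, Fin.cons_succ] at this
      rw [show (1 : Fin (m + 2)) = Fin.succ 0 from rfl, Fin.cons_succ, Fin.cons_zero,
        add_zero] at this
      exact this

end ProjectedD

/-! ### Systems of vectors of norm three with products `±1` -/

section ClosedSystem

variable {E : Type*} [NormedAddCommGroup E] [InnerProductSpace ℝ E]

/-- A symmetric set of vectors of norm `3`, non-proportional ones having product `±1`, that
contains `x + y + z` whenever it contains `x`, `y`, `z` with pairwise products `-1` (such a sum
has norm `3`). The minimal vectors of an integral lattice of minimum `3` form such a set if they
support equiangular lines that are not pairwise orthogonal. -/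
structure IsClosedSystem (S : Set E) : Prop where
  inner_self : ∀ x ∈ S, ⟪x, x⟫_ℝ = 3
  neg_mem : ∀ x ∈ S, -x ∈ S
  pair : ∀ x ∈ S, ∀ y ∈ S, y = x ∨ y = -x ∨ ⟪x, y⟫_ℝ = 1 ∨ ⟪x, y⟫_ℝ = -1
  triple_mem : ∀ x ∈ S, ∀ y ∈ S, ∀ z ∈ S, ⟪x, y⟫_ℝ = -1 → ⟪x, z⟫_ℝ = -1 → ⟪y, z⟫_ℝ = -1 →
    x + y + z ∈ S

lemma eq_of_inner_sub_self_eq_zero {x y : E} (h : ⟪x - y, x - y⟫_ℝ = 0) : x = y :=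
  sub_eq_zero.1 (inner_self_eq_zero.1 h)

/-- Vectors of norm `3` with all products equal to some `k ∈ [0, 3)` are independent: their Gram
matrix `(3 - k) I + k J` is positive definite. -/
lemma linearIndependent_of_inner_eq {ι : Type*} {v : ι → E} {k : ℝ} (hk0 : 0 ≤ k) (hk : k < 3)
    (hv : ∀ i, ⟪v i, v i⟫_ℝ = 3) (hv' : ∀ i j, i ≠ j → ⟪v i, v j⟫_ℝ = k) :
    LinearIndependent ℝ v := by
  classical
  rw [linearIndependent_iff']
  intro s g hg
  have h1 : ∀ i j, ⟪v i, v j⟫_ℝ = (if i = j then 3 - k else 0) + k := by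
    intro i j
    split_ifs with hij
    · rw [hij, hv]; ring
    · rw [hv' i j hij, zero_add]
  have h2 : (3 - k) * ∑ i ∈ s, g i * g i + k * (∑ i ∈ s, g i) * (∑ i ∈ s, g i) = 0 := by
    have h3 : ⟪∑ i ∈ s, g i • v i, ∑ j ∈ s, g j • v j⟫_ℝ = 0 := by rw [hg, inner_zero_left]
    rw [sum_inner] at h3
    rw [← h3, Finset.mul_sum, Finset.mul_sum, ← Finset.sum_add_distrib]
    refine Finset.sum_congr rfl fun i hi => ?_
    have h4 : ∀ j ∈ s, ⟪g i • v i, g j • v j⟫_ℝ =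
        (if i = j then g i * g j * (3 - k) else 0) + g i * k * g j := by
      intro j _
      rw [real_inner_smul_left, real_inner_smul_right, h1]
      split_ifs <;> ring
    rw [inner_sum, Finset.sum_congr rfl h4, Finset.sum_add_distrib, Finset.sum_ite_eq, if_pos hi,
      ← Finset.mul_sum]
    ring
  have h5 : 0 ≤ ∑ i ∈ s, g i * g i := Finset.sum_nonneg fun i _ => mul_self_nonneg _
  have h6 : ∑ i ∈ s, g i * g i = 0 := by
    have h7 : 0 ≤ k * (∑ i ∈ s, g i) * (∑ i ∈ s, g i) := by
      rw [mul_assoc]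
      exact mul_nonneg hk0 (mul_self_nonneg _)
    nlinarith
  intro i hi
  exact mul_self_eq_zero.1
    ((Finset.sum_eq_zero_iff_of_nonneg fun i _ => mul_self_nonneg _).1 h6 i hi)

lemma ncard_lines_le_finrank [FiniteDimensional ℝ E] {X : Set (Submodule ℝ E)} {R : Set E}
    {k : ℝ} (hk0 : 0 ≤ k) (hk : k < 3) (hR : ∀ x ∈ R, ⟪x, x⟫_ℝ = 3)
    (hR' : ∀ x ∈ R, ∀ y ∈ R, x ≠ y → ⟪x, y⟫_ℝ = k)
    (hX : X ⊆ (fun x => Submodule.span ℝ {x}) '' R) : X.ncard ≤ Module.finrank ℝ E := by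
  have hli : LinearIndependent ℝ (fun x : R => (x : E)) :=
    linearIndependent_of_inner_eq hk0 hk (fun x => hR x x.2)
      fun x y hxy => hR' x x.2 y y.2 fun h => hxy (Subtype.ext h)
  have hfin : R.Finite := hli.setFinite
  have := hfin.fintype
  calc X.ncard ≤ ((fun x => Submodule.span ℝ {x}) '' R).ncard :=
        Set.ncard_le_ncard hX (hfin.image _)
    _ ≤ R.ncard := Set.ncard_image_le hfin
    _ = Fintype.card R := by rw [← Nat.card_coe_set_eq, Nat.card_eq_fintype_card]
    _ ≤ Module.finrank ℝ E := hli.fintype_card_le_finrank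

/-- For pairwise non-proportional `a`, `b`, `c` with products `-1`, the vectors of `S` having
products `1`, `1`, `-1` with them: up to sign, one of the three classes (pillars) of the vectors
of `S` other than `± a`, `± b`, `± c`, `± (a + b + c)`. -/
structure InPillar (S : Set E) (a b c x : E) : Prop where
  mem : x ∈ S
  left : ⟪x, a⟫_ℝ = 1
  right : ⟪x, b⟫_ℝ = 1
  third : ⟪x, c⟫_ℝ = -1

lemma InPillar.symm {S : Set E} {a b c x : E} (h : InPillar S a b c x) : InPillar S b a c x :=
  ⟨h.mem, h.right, h.left, h.third⟩

namespace IsClosedSystem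

variable {S : Set E} (hS : IsClosedSystem S)
include hS

/-- If no three vectors of `S` have pairwise products `-1`, the vectors of `S` having a positive
product with a fixed one have pairwise products `1`. -/
lemma ncard_lines_le_of_no_triple [FiniteDimensional ℝ E] {X : Set (Submodule ℝ E)}
    (hX : X ⊆ (fun x => Submodule.span ℝ {x}) '' S)
    (hno : ∀ a ∈ S, ∀ b ∈ S, ∀ c ∈ S, ⟪a, b⟫_ℝ = -1 → ⟪a, c⟫_ℝ = -1 → ⟪b, c⟫_ℝ ≠ -1) :
    X.ncard ≤ Module.finrank ℝ E := by
  rcases S.eq_empty_or_nonempty with rfl | ⟨x₀, hx₀⟩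
  · rw [Set.image_empty, Set.subset_empty_iff] at hX
    simp [hX]
  refine ncard_lines_le_finrank (R := {x ∈ S | 0 < ⟪x₀, x⟫_ℝ}) (k := 1) zero_le_one (by norm_num)
    (fun x hx => hS.inner_self x hx.1) ?_ ?_
  · rintro x ⟨hx, hx0⟩ y ⟨hy, hy0⟩ hxy
    have h3 := hS.inner_self x₀ hx₀
    rcases hS.pair x hx y hy with h | h | h | h
    · exact absurd h.symm hxy
    · rw [h, inner_neg_right] at hy0
      linarith
    · exact h
    · exfalso
      rcases hS.pair x₀ hx₀ x hx with rfl | rfl | h1 | h1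
      · linarith
      · rw [inner_neg_right] at hx0
        linarith
      · rcases hS.pair x₀ hx₀ y hy with rfl | rfl | h2 | h2
        · rw [real_inner_comm] at h
          linarith
        · rw [inner_neg_right] at hy0
          linarith
        · exact hno (-x₀) (hS.neg_mem _ hx₀) x hx y hy (by rw [inner_neg_left, h1])
            (by rw [inner_neg_left, h2]) h
        · linarith
      · linarith
  · intro l hl
    obtain ⟨x, hx, rfl⟩ := hX hl
    have hne : ⟪x₀, x⟫_ℝ ≠ 0 := by
      have h3 := hS.inner_self x₀ hx₀
      rcases hS.pair x₀ hx₀ x hx with rfl | rfl | h1 | h1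
      · rw [h3]; norm_num
      · rw [inner_neg_right, h3]; norm_num
      · rw [h1]; norm_num
      · rw [h1]; norm_num
    rcases hne.lt_or_gt with h | h
    · refine ⟨-x, ⟨hS.neg_mem x hx, by rw [inner_neg_right]; linarith⟩, ?_⟩
      simp only
      rw [← Set.neg_singleton, Submodule.span_neg]
    · exact ⟨x, ⟨hx, h⟩, rfl⟩

/-- If `a · b = -1` and no vector of `S` is orthogonal to `a + b`, then `S` consists of the vectors
`± u ± w i` of a frame with `u = (a + b) / 2`. -/
lemma exists_frame [FiniteDimensional ℝ E] (hspan : Submodule.span ℝ S = ⊤) {a b : E}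
    (ha : a ∈ S) (hb : b ∈ S) (hab : ⟪a, b⟫_ℝ = -1)
    (hall : ∀ x ∈ S, ⟪x, a⟫_ℝ + ⟪x, b⟫_ℝ ≠ 0) :
    ∃ (m : ℕ) (u : E) (w : Fin m → E), 0 < m ∧ IsFrame u w ∧
      Submodule.span ℤ S = frameLattice u w := by
  classical
  have haa := hS.inner_self a ha
  have hbb := hS.inner_self b hb
  have hba : ⟪b, a⟫_ℝ = -1 := by rw [real_inner_comm, hab]
  obtain ⟨u, hu⟩ : ∃ u : E, u = (1 / 2 : ℝ) • (a + b) := ⟨_, rfl⟩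
  have hxu : ∀ x, ⟪x, u⟫_ℝ = (⟪x, a⟫_ℝ + ⟪x, b⟫_ℝ) / 2 := fun x => by
    rw [hu, inner_smul_right, inner_add_right]; ring
  have hua : ⟪u, a⟫_ℝ = 1 := by
    rw [real_inner_comm, hxu, haa, hab]; norm_num
  have hub : ⟪u, b⟫_ℝ = 1 := by
    rw [real_inner_comm, hxu, hbb, hba]; norm_num
  have huu : ⟪u, u⟫_ℝ = 1 := by rw [hxu, hua, hub]; norm_num
  have h2u : u + u = a + b := by rw [hu]; module
  -- up to sign, a vector of `S` is `a`, `b`, or has product `1` with both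
  have hcase : ∀ x ∈ S, (x = a ∨ x = b ∨ (⟪x, a⟫_ℝ = 1 ∧ ⟪x, b⟫_ℝ = 1)) ∨
      (-x = a ∨ -x = b ∨ (⟪-x, a⟫_ℝ = 1 ∧ ⟪-x, b⟫_ℝ = 1)) := by
    intro x hx
    have h0 := hall x hx
    rcases hS.pair x hx a ha with h | h | h | h
    · exact Or.inl (Or.inl h.symm)
    · exact Or.inr (Or.inl h.symm)
    · rcases hS.pair x hx b hb with h' | h' | h' | h'
      · exact Or.inl (Or.inr (Or.inl h'.symm))
      · exact Or.inr (Or.inr (Or.inl h'.symm))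
      · exact Or.inl (Or.inr (Or.inr ⟨h, h'⟩))
      · rw [h, h'] at h0; norm_num at h0
    · rcases hS.pair x hx b hb with h' | h' | h' | h'
      · exact Or.inl (Or.inr (Or.inl h'.symm))
      · exact Or.inr (Or.inr (Or.inl h'.symm))
      · rw [h, h'] at h0; norm_num at h0
      · refine Or.inr (Or.inr (Or.inr ⟨?_, ?_⟩)) <;> rw [inner_neg_left]
        · rw [h]; norm_num
        · rw [h']; norm_num
  have hcaseu : ∀ x, (x = a ∨ x = b ∨ (⟪x, a⟫_ℝ = 1 ∧ ⟪x, b⟫_ℝ = 1)) → ⟪x, u⟫_ℝ = 1 := by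
    rintro x (rfl | rfl | ⟨h, h'⟩)
    · rw [real_inner_comm, hua]
    · rw [real_inner_comm, hub]
    · rw [hxu, h, h']; norm_num
  have hrefl : ∀ x ∈ S, (x = a ∨ x = b ∨ (⟪x, a⟫_ℝ = 1 ∧ ⟪x, b⟫_ℝ = 1)) → u + u - x ∈ S := by
    rintro x hx (rfl | rfl | ⟨h, h'⟩)
    · rw [h2u, add_sub_cancel_left]; exact hb
    · rw [h2u, add_sub_cancel_right]; exact ha
    · rw [h2u, sub_eq_add_neg]
      exact hS.triple_mem _ ha _ hb _ (hS.neg_mem _ hx) hab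
        (by rw [inner_neg_right, real_inner_comm, h])
        (by rw [inner_neg_right, real_inner_comm, h'])
  let W : Set E := {w | u + w ∈ S ∧ ⟪w, u⟫_ℝ = 0}
  have hWmem : ∀ x ∈ S, ⟪x, u⟫_ℝ = 1 → x - u ∈ W := by
    intro x hx h1
    refine ⟨by rwa [add_sub_cancel], ?_⟩
    rw [inner_sub_left, h1, huu, sub_self]
  have hWu : ∀ w ∈ W, ⟪u + w, u⟫_ℝ = 1 := by
    intro w hw
    rw [inner_add_left, huu, hw.2, add_zero]
  have hWcase : ∀ w ∈ W, (u + w = a ∨ u + w = b ∨ (⟪u + w, a⟫_ℝ = 1 ∧ ⟪u + w, b⟫_ℝ = 1)) := by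
    intro w hw
    rcases hcase _ hw.1 with h | h
    · exact h
    · have h1 := hcaseu _ h
      rw [inner_neg_left, hWu w hw] at h1
      norm_num at h1
  have hWneg : ∀ w ∈ W, u - w ∈ S := by
    intro w hw
    have := hrefl _ hw.1 (hWcase w hw)
    rwa [add_sub_add_left_eq_sub] at this
  have hSW : ∀ x ∈ S, x - u ∈ W ∨ -x - u ∈ W := by
    intro x hx
    rcases hcase x hx with h | h
    · exact Or.inl (hWmem x hx (hcaseu x h))
    · exact Or.inr (hWmem _ (hS.neg_mem x hx) (hcaseu _ h))
  have hWinner : ∀ w ∈ W, ∀ w' ∈ W, ⟪u + w, u + w'⟫_ℝ = 1 + ⟪w, w'⟫_ℝ := by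
    intro w hw w' hw'
    rw [inner_add_left, inner_add_right, inner_add_right, huu, hw.2, real_inner_comm w' u, hw'.2]
    ring
  have hW2 : ∀ w ∈ W, ⟪w, w⟫_ℝ = 2 := by
    intro w hw
    have h1 := hWinner w hw w hw
    rw [hS.inner_self _ hw.1] at h1
    linarith
  have hWpair : ∀ w ∈ W, ∀ w' ∈ W, w' = w ∨ w' = -w ∨ ⟪w, w'⟫_ℝ = 0 := by
    intro w hw w' hw'
    have h1 := hWinner w hw w' hw'
    rcases hS.pair _ hw.1 _ hw'.1 with h | h | h | h
    · exact Or.inl (add_left_cancel h)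
    · exfalso
      have h2 := hWu w' hw'
      rw [h, inner_neg_left, hWu w hw] at h2
      norm_num at h2
    · exact Or.inr (Or.inr (by linarith))
    · refine Or.inr (Or.inl (eq_of_inner_sub_self_eq_zero ?_))
      have h4 := hW2 w hw
      have h5 := hW2 w' hw'
      rw [sub_neg_eq_add, inner_add_left, inner_add_right, inner_add_right,
        real_inner_comm w w', h4, h5]
      linarith
  obtain ⟨B, hBW, hBspan, hBli⟩ := exists_linearIndependent ℝ W
  have hBfin : B.Finite := hBli.setFinite
  have := hBfin.fintype
  have hBorth : ∀ w ∈ B, ∀ w' ∈ B, w ≠ w' → ⟪w, w'⟫_ℝ = 0 := by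
    intro w hw w' hw' hne
    rcases hWpair w (hBW hw) w' (hBW hw') with h | h | h
    · exact absurd h.symm hne
    · exfalso
      have hinj : Function.Injective ![(⟨w, hw⟩ : B), ⟨w', hw'⟩] := by
        intro i j hij
        fin_cases i <;> fin_cases j <;> simp_all
      have hpair := hBli.comp _ hinj
      have hval : (Subtype.val : B → E) ∘ ![(⟨w, hw⟩ : B), ⟨w', hw'⟩] = ![w, w'] := by
        ext i
        fin_cases i <;> rfl
      rw [hval] at hpair
      exact one_ne_zero (LinearIndependent.pair_iff.1 hpair 1 1 (by rw [h]; simp)).1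
    · exact h
  -- a vector of `W` outside `± B` would be orthogonal to the span of `W`
  have hWB : ∀ w ∈ W, w ∈ B ∨ -w ∈ B := by
    intro w hw
    by_contra hcon
    push Not at hcon
    have horth : ∀ x ∈ Submodule.span ℝ B, ⟪w, x⟫_ℝ = 0 := by
      intro x hx
      induction hx using Submodule.span_induction with
      | mem x hx =>
        rcases hWpair w hw x (hBW hx) with h | h | h
        · exact absurd (h ▸ hx) hcon.1
        · exact absurd (h ▸ hx) hcon.2
        · exact h
      | zero => exact inner_zero_right _
      | add x y _ _ hx hy => rw [inner_add_right, hx, hy, add_zero]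
      | smul c x _ hx => rw [inner_smul_right, hx, mul_zero]
    have h0 := horth w (hBspan ▸ Submodule.subset_span hw)
    rw [hW2 w hw] at h0
    norm_num at h0
  have hframe : IsFrame u (fun w : B => (w : E)) := by
    refine ⟨huu, fun w => ?_, fun w => hW2 _ (hBW w.2), fun w w' hne =>
      hBorth _ w.2 _ w'.2 fun h => hne (Subtype.ext h), ?_⟩
    · rw [real_inner_comm, (hBW w.2).2]
    · rw [eq_top_iff, ← hspan, Submodule.span_le, Subtype.range_coe]
      have hV : ∀ w ∈ W, u + w ∈ Submodule.span ℝ (insert u B) := by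
        intro w hw
        refine add_mem (Submodule.subset_span (Set.mem_insert _ _)) ?_
        refine Submodule.span_mono (Set.subset_insert _ _) ?_
        rw [hBspan]
        exact Submodule.subset_span hw
      intro x hx
      rcases hSW x hx with h | h
      · have := hV _ h
        rwa [add_sub_cancel] at this
      · have := hV _ h
        rw [add_sub_cancel] at this
        exact (Submodule.neg_mem_iff _).1 this
  have hlat : Submodule.span ℤ S = frameLattice u (fun w : B => (w : E)) := by
    apply le_antisymm
    · rw [Submodule.span_le]
      have hV : ∀ w ∈ W, u + w ∈ frameLattice u (fun w : B => (w : E)) := by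
        intro w hw
        rcases hWB w hw with h | h
        · exact frameVector_mem u (fun w : B => (w : E)) (⟨w, h⟩, true)
        · have := frameVector_mem u (fun w : B => (w : E)) (⟨-w, h⟩, false)
          simpa [frameVector] using this
      intro x hx
      rcases hSW x hx with h | h
      · have := hV _ h
        rwa [add_sub_cancel] at this
      · have := hV _ h
        rw [add_sub_cancel] at this
        exact (Submodule.neg_mem_iff _).1 this
    · rw [frameLattice, Submodule.span_le]
      rintro _ ⟨⟨w, c⟩, rfl⟩
      apply Submodule.subset_span
      cases c
      · exact hWneg _ (hBW w.2)
      · exact (hBW w.2).1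
  let e : Fin (Fintype.card B) ≃ B := (Fintype.equivFin B).symm
  refine ⟨Fintype.card B, u, (fun w : B => (w : E)) ∘ e, ?_, hframe.comp_equiv e, ?_⟩
  · rw [Fintype.card_pos_iff]
    have haW := hWmem a ha (by rw [real_inner_comm, hua])
    rcases hWB _ haW with h | h
    · exact ⟨⟨_, h⟩⟩
    · exact ⟨⟨_, h⟩⟩
  · rw [hlat, frameLattice_comp_equiv]

end IsClosedSystem

end ClosedSystem

/-! ### Systems with two nonempty pillars -/

section Pillars

variable {E : Type*} [NormedAddCommGroup E] [InnerProductSpace ℝ E]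

/-- Four pairwise orthogonal vectors `eᵢ` and a vector `d`, all of norm `2`, with `d · eᵢ = ± 1`:
equality holds in Bessel's inequality. -/
lemma eq_half_smul_sum {d : E} {e : Fin 4 → E} {t : Fin 4 → ℝ} (hd : ⟪d, d⟫_ℝ = 2)
    (he : ∀ i, ⟪e i, e i⟫_ℝ = 2) (he' : ∀ i j, i ≠ j → ⟪e i, e j⟫_ℝ = 0)
    (hde : ∀ i, ⟪d, e i⟫_ℝ = t i) (ht : ∀ i, t i * t i = 1) :
    d = (1 / 2 : ℝ) • ∑ i, t i • e i := by
  apply eq_of_inner_sub_self_eq_zero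
  have h1 : ⟪d, ∑ i, t i • e i⟫_ℝ = 4 := by
    simp only [inner_sum, inner_smul_right, hde, ht]
    simp
  have h2 : ⟪∑ i, t i • e i, ∑ i, t i • e i⟫_ℝ = 8 := by
    have h3 : ∀ i, ⟪e i, ∑ j, t j • e j⟫_ℝ = 2 * t i := by
      intro i
      rw [inner_sum, Finset.sum_eq_single i]
      · rw [inner_smul_right, he]; ring
      · intro j _ hj
        rw [inner_smul_right, he' i j hj.symm, mul_zero]
      · simp
    have h4 : ∀ i, t i * (2 * t i) = 2 := fun i => by linear_combination 2 * ht i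
    simp only [sum_inner, real_inner_smul_left, h3, h4]
    norm_num
  have h1' : ⟪∑ i, t i • e i, d⟫_ℝ = 4 := by rw [real_inner_comm, h1]
  simp only [inner_sub_left, inner_sub_right, real_inner_smul_left, inner_smul_right, hd, h1, h1',
    h2]
  norm_num

lemma InPillar.inner_eq {S : Set E} (hS : IsClosedSystem S) {a b c x y : E}
    (hx : InPillar S a b c x) (hy : InPillar S a c b y) :
    ⟪x, y⟫_ℝ = 1 ∨ ⟪x, y⟫_ℝ = -1 := by
  rcases hS.pair x hx.mem y hy.mem with h | h | h
  · have h1 := hx.right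
    have h2 := hy.third
    rw [h] at h2
    linarith
  · have h1 := hx.left
    have h2 := hy.left
    rw [h, inner_neg_left] at h2
    linarith
  · exact h

namespace IsClosedSystem

variable {S : Set E} (hS : IsClosedSystem S) {a b c : E} (ha : a ∈ S) (hb : b ∈ S) (hc : c ∈ S)
  (hab : ⟪a, b⟫_ℝ = -1) (hac : ⟪a, c⟫_ℝ = -1) (hbc : ⟪b, c⟫_ℝ = -1)
include hS ha hb hab

/-- The pillar of `a`, `b` is symmetric about `(a + b) / 2`. -/
lemma inPillar_reflect (hac : ⟪a, c⟫_ℝ = -1) (hbc : ⟪b, c⟫_ℝ = -1) {x : E}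
    (hx : InPillar S a b c x) : InPillar S a b c (a + b - x) := by
  have haa := hS.inner_self a ha
  have hbb := hS.inner_self b hb
  have hba : ⟪b, a⟫_ℝ = -1 := by rw [real_inner_comm, hab]
  obtain ⟨hm, h1, h2, h3⟩ := hx
  refine ⟨?_, ?_, ?_, ?_⟩
  · rw [sub_eq_add_neg]
    exact hS.triple_mem _ ha _ hb _ (hS.neg_mem _ hm) hab
      (by rw [inner_neg_right, real_inner_comm, h1]) (by rw [inner_neg_right, real_inner_comm, h2])
  · rw [inner_sub_left, inner_add_left]; linarith
  · rw [inner_sub_left, inner_add_left]; linarith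
  · rw [inner_sub_left, inner_add_left]; linarith

/-- Two vectors of a pillar are equal, symmetric about `(a + b) / 2`, or have product `1`. -/
lemma inPillar_pair {x y : E} (hx : InPillar S a b c x) (hy : InPillar S a b c y) :
    y = x ∨ y = a + b - x ∨ ⟪x, y⟫_ℝ = 1 := by
  have haa := hS.inner_self a ha
  have hbb := hS.inner_self b hb
  have hba : ⟪b, a⟫_ℝ = -1 := by rw [real_inner_comm, hab]
  have hxx := hS.inner_self x hx.mem
  have hyy := hS.inner_self y hy.mem
  have hx1 := hx.left
  have hx2 := hx.right
  have hy1 := hy.left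
  have hy2 := hy.right
  have hx1' : ⟪a, x⟫_ℝ = 1 := by rw [real_inner_comm, hx1]
  have hx2' : ⟪b, x⟫_ℝ = 1 := by rw [real_inner_comm, hx2]
  have hy1' : ⟪a, y⟫_ℝ = 1 := by rw [real_inner_comm, hy1]
  have hy2' : ⟪b, y⟫_ℝ = 1 := by rw [real_inner_comm, hy2]
  rcases hS.pair x hx.mem y hy.mem with h | h | h | h
  · exact Or.inl h
  · rw [h, inner_neg_left] at hy1
    linarith
  · exact Or.inr (Or.inr h)
  · refine Or.inr (Or.inl (eq_of_inner_sub_self_eq_zero ?_))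
    have h' : ⟪y, x⟫_ℝ = -1 := by rw [real_inner_comm, h]
    simp only [inner_sub_left, inner_sub_right, inner_add_left, inner_add_right, *]
    norm_num

include hc hac hbc

omit hb hc hbc in
/-- Vectors `x`, `y` with `x · y = -1` in the pillars of `a`, `b` and `a`, `c` yield the vector
`x + y - a` in the third pillar. -/
lemma inPillar_add {x y : E} (hx : InPillar S a b c x) (hy : InPillar S a c b y)
    (hxy : ⟪x, y⟫_ℝ = -1) : InPillar S b c a (x + y - a) := by
  have haa := hS.inner_self a ha
  obtain ⟨hxm, hx1, hx2, hx3⟩ := hx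
  obtain ⟨hym, hy1, hy2, hy3⟩ := hy
  refine ⟨?_, ?_, ?_, ?_⟩
  · rw [sub_eq_add_neg]
    exact hS.triple_mem _ hxm _ hym _ (hS.neg_mem _ ha) hxy
      (by rw [inner_neg_right, hx1]) (by rw [inner_neg_right, hy1])
  · rw [inner_sub_left, inner_add_left]; linarith
  · rw [inner_sub_left, inner_add_left]; linarith
  · rw [inner_sub_left, inner_add_left]; linarith

/-- The three pillars exhaust `S` apart from `± a`, `± b`, `± c`, `± (a + b + c)`. -/
lemma cases_pillar {x : E} (hx : x ∈ S) :
    ∃ y, (y = x ∨ y = -x) ∧ (y = a ∨ y = b ∨ y = c ∨ y = a + b + c ∨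
      InPillar S a b c y ∨ InPillar S a c b y ∨ InPillar S b c a y) := by
  have haa := hS.inner_self a ha
  have hbb := hS.inner_self b hb
  have hcc := hS.inner_self c hc
  have hxx := hS.inner_self x hx
  have hba : ⟪b, a⟫_ℝ = -1 := by rw [real_inner_comm, hab]
  have hca : ⟪c, a⟫_ℝ = -1 := by rw [real_inner_comm, hac]
  have hcb : ⟪c, b⟫_ℝ = -1 := by rw [real_inner_comm, hbc]
  have hsum : ∀ y ∈ S, ⟪y, a⟫_ℝ = 1 → ⟪y, b⟫_ℝ = 1 → ⟪y, c⟫_ℝ = 1 → y = a + b + c := by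
    intro y hy h1 h2 h3
    apply eq_of_inner_sub_self_eq_zero
    have hyy := hS.inner_self y hy
    have h1' : ⟪a, y⟫_ℝ = 1 := by rw [real_inner_comm, h1]
    have h2' : ⟪b, y⟫_ℝ = 1 := by rw [real_inner_comm, h2]
    have h3' : ⟪c, y⟫_ℝ = 1 := by rw [real_inner_comm, h3]
    simp only [inner_sub_left, inner_sub_right, inner_add_left, inner_add_right, *]
    norm_num
  have hnx := hS.neg_mem x hx
  rcases hS.pair x hx a ha with h1 | h1 | h1 | h1
  · exact ⟨x, by simp, by simp [h1]⟩
  · exact ⟨-x, by simp, by simp [h1]⟩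
  all_goals
    rcases hS.pair x hx b hb with h2 | h2 | h2 | h2
    · exact ⟨x, by simp, by simp [h2]⟩
    · exact ⟨-x, by simp, by simp [h2]⟩
    all_goals
      rcases hS.pair x hx c hc with h3 | h3 | h3 | h3
      · exact ⟨x, by simp, by simp [h3]⟩
      · exact ⟨-x, by simp, by simp [h3]⟩
      all_goals
        have hn1 : ⟪-x, a⟫_ℝ = -⟪x, a⟫_ℝ := inner_neg_left _ _
        have hn2 : ⟪-x, b⟫_ℝ = -⟪x, b⟫_ℝ := inner_neg_left _ _
        have hn3 : ⟪-x, c⟫_ℝ = -⟪x, c⟫_ℝ := inner_neg_left _ _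
        rw [h1] at hn1
        rw [h2] at hn2
        rw [h3] at hn3
        try simp only [neg_neg] at hn1 hn2 hn3
        first
        | exact ⟨x, Or.inl rfl, by simp [hsum x hx h1 h2 h3]⟩
        | exact ⟨-x, Or.inr rfl, Or.inr (Or.inr (Or.inr (Or.inl (hsum (-x) hnx hn1 hn2 hn3))))⟩
        | exact ⟨x, Or.inl rfl, Or.inr (Or.inr (Or.inr (Or.inr (Or.inl ⟨hx, h1, h2, h3⟩))))⟩
        | exact ⟨-x, Or.inr rfl, Or.inr (Or.inr (Or.inr (Or.inr (Or.inl ⟨hnx, hn1, hn2, hn3⟩))))⟩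
        | exact ⟨x, Or.inl rfl,
            Or.inr (Or.inr (Or.inr (Or.inr (Or.inr (Or.inl ⟨hx, h1, h3, h2⟩)))))⟩
        | exact ⟨-x, Or.inr rfl,
            Or.inr (Or.inr (Or.inr (Or.inr (Or.inr (Or.inl ⟨hnx, hn1, hn3, hn2⟩)))))⟩
        | exact ⟨x, Or.inl rfl,
            Or.inr (Or.inr (Or.inr (Or.inr (Or.inr (Or.inr ⟨hx, h2, h3, h1⟩)))))⟩
        | exact ⟨-x, Or.inr rfl,
            Or.inr (Or.inr (Or.inr (Or.inr (Or.inr (Or.inr ⟨hnx, hn2, hn3, hn1⟩)))))⟩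

/-- A vector of `S` orthogonal to `a + b` lies, up to sign, in the second or third pillar. -/
lemma exists_inPillar_of_inner_eq_zero {x : E} (hx : x ∈ S) (h0 : ⟪x, a⟫_ℝ + ⟪x, b⟫_ℝ = 0) :
    (∃ y, InPillar S a c b y) ∨ ∃ y, InPillar S b c a y := by
  have haa := hS.inner_self a ha
  have hbb := hS.inner_self b hb
  have hba : ⟪b, a⟫_ℝ = -1 := by rw [real_inner_comm, hab]
  have hca : ⟪c, a⟫_ℝ = -1 := by rw [real_inner_comm, hac]
  have hcb : ⟪c, b⟫_ℝ = -1 := by rw [real_inner_comm, hbc]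
  obtain ⟨y, hy, h⟩ := hS.cases_pillar ha hb hc hab hac hbc hx
  have hy0 : ⟪y, a⟫_ℝ + ⟪y, b⟫_ℝ = 0 := by
    rcases hy with rfl | rfl
    · exact h0
    · rw [inner_neg_left, inner_neg_left]; linarith
  rcases h with rfl | rfl | rfl | rfl | h | h | h
  · linarith
  · linarith
  · linarith
  · simp only [inner_add_left] at hy0; linarith
  · linarith [h.left, h.right]
  · exact Or.inl ⟨y, h⟩
  · exact Or.inr ⟨y, h⟩

/-- If two pillars contain vectors `z`, `y` with `z · y = -1`, then `a`, `b`, `c`, `y` and the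
pillar of `a`, `b` span the whole space. -/
lemma eq_top_of_pillar_subset (hspan : Submodule.span ℝ S = ⊤) {z y : E}
    (hz : InPillar S a b c z) (hy : InPillar S a c b y) (hzy : ⟪z, y⟫_ℝ = -1)
    (V : Submodule ℝ E) (haV : a ∈ V) (hbV : b ∈ V) (hcV : c ∈ V) (hyV : y ∈ V)
    (hV : ∀ x, InPillar S a b c x → x ∈ V) : V = ⊤ := by
  have hba : ⟪b, a⟫_ℝ = -1 := by rw [real_inner_comm, hab]
  have hca : ⟪c, a⟫_ℝ = -1 := by rw [real_inner_comm, hac]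
  have hcb : ⟪c, b⟫_ℝ = -1 := by rw [real_inner_comm, hbc]
  -- `f + g - c` lies in the first pillar for `f`, `g` in the other two with `f · g = -1`
  have key : ∀ f g, InPillar S b c a f → InPillar S a c b g → f ∈ V ∨ g ∈ V →
      f ∈ V ∧ g ∈ V := by
    have key1 : ∀ f g, InPillar S b c a f → InPillar S a c b g → ⟪f, g⟫_ℝ = -1 → f ∈ V ∨ g ∈ V →
        f ∈ V ∧ g ∈ V := by
      intro f g hf hg hfg hor
      have h1 := hV _ (hS.inPillar_add hc hcb hca hf.symm hg.symm hfg).symm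
      rcases hor with h | h
      · refine ⟨h, ?_⟩
        have := V.add_mem (V.sub_mem h1 h) hcV
        rwa [show f + g - c - f + c = g by abel] at this
      · refine ⟨?_, h⟩
        have := V.add_mem (V.sub_mem h1 h) hcV
        rwa [show f + g - c - g + c = f by abel] at this
    intro f g hf hg hor
    rcases InPillar.inner_eq hS hf.symm hg.symm with h | h
    · -- replace `f` by its reflection `b + c - f`
      have hf' := hS.inPillar_reflect hb hc hbc hba hca hf
      have h' : ⟪b + c - f, g⟫_ℝ = -1 := by
        rw [inner_sub_left, inner_add_left, real_inner_comm, hg.third, real_inner_comm, hg.right, h]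
        norm_num
      have hbcV := V.add_mem hbV hcV
      have h2 := key1 _ g hf' hg h' (hor.imp (fun h => V.sub_mem hbcV h) id)
      refine ⟨?_, h2.2⟩
      have := V.sub_mem hbcV h2.1
      rwa [sub_sub_cancel] at this
    · exact key1 f g hf hg h hor
  have hzyV := hS.inPillar_add ha hab hac hz hy hzy
  have hzyV' := (key _ y hzyV hy (Or.inr hyV)).1
  rw [eq_top_iff, ← hspan, Submodule.span_le]
  intro x hx
  obtain ⟨x', hx', h⟩ := hS.cases_pillar ha hb hc hab hac hbc hx
  have hx'V : x' ∈ V := by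
    rcases h with rfl | rfl | rfl | rfl | h | h | h
    · exact haV
    · exact hbV
    · exact hcV
    · exact V.add_mem (V.add_mem haV hbV) hcV
    · exact hV _ h
    · exact (key _ x' hzyV h (Or.inl hzyV')).2
    · exact (key x' y h hy (Or.inr hyV)).1
  rcases hx' with rfl | rfl
  · exact hx'V
  · exact V.neg_mem_iff.1 hx'V

lemma five_le_finrank [FiniteDimensional ℝ E] {z y : E}
    (hz : InPillar S a b c z) (hy : InPillar S a c b y) (hzy : ⟪z, y⟫_ℝ = -1) :
    5 ≤ Module.finrank ℝ E := by
  have hli : LinearIndependent ℝ ![a, b, c, z, y] := by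
    rw [Fintype.linearIndependent_iff]
    intro g hg
    have hinner : ∀ v, ⟪∑ i, g i • ![a, b, c, z, y] i, v⟫_ℝ = 0 := fun v => by
      rw [hg, inner_zero_left]
    simp only [Fin.sum_univ_five, inner_add_left, real_inner_smul_left] at hinner
    have h1 := hinner a
    have h2 := hinner b
    have h3 := hinner c
    have h4 := hinner z
    have h5 := hinner y
    simp only [Matrix.cons_val] at h1 h2 h3 h4 h5
    rw [hS.inner_self a ha, real_inner_comm a b, real_inner_comm a c, hab, hac, hz.left,
      hy.left] at h1
    rw [hS.inner_self b hb, hab, real_inner_comm b c, hbc, hz.right, hy.third] at h2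
    rw [hS.inner_self c hc, hac, hbc, hz.third, hy.right] at h3
    rw [hS.inner_self z hz.mem, real_inner_comm z a, real_inner_comm z b, real_inner_comm z c,
      real_inner_comm z y, hz.left, hz.right, hz.third, hzy] at h4
    rw [hS.inner_self y hy.mem, real_inner_comm y a, real_inner_comm y b, real_inner_comm y c,
      hy.left, hy.right, hy.third, hzy] at h5
    intro i
    fin_cases i <;> simp only [Fin.zero_eta, Fin.mk_one, Fin.reduceFinMk] <;> linarith
  simpa using hli.fintype_card_le_finrank

/-- A pillar contains at most four pairwise non-symmetric vectors if another pillar is nonempty,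
and four of them span a vector of the other pillar; this bounds the dimension. -/
lemma finrank_le_seven (hspan : Submodule.span ℝ S = ⊤) {z y : E}
    (hz : InPillar S a b c z) (hy : InPillar S a c b y) (hzy : ⟪z, y⟫_ℝ = -1) :
    Module.finrank ℝ E ≤ 7 := by
  by_contra hdim
  have haa := hS.inner_self a ha
  have hbb := hS.inner_self b hb
  have hcc := hS.inner_self c hc
  have hyy := hS.inner_self y hy.mem
  have hba : ⟪b, a⟫_ℝ = -1 := by rw [real_inner_comm, hab]
  have hca : ⟪c, a⟫_ℝ = -1 := by rw [real_inner_comm, hac]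
  have hcb : ⟪c, b⟫_ℝ = -1 := by rw [real_inner_comm, hbc]
  have hex : ∀ p q r : E, ∃ x, InPillar S a b c x ∧
      x ∉ Submodule.span ℝ (Set.range ![a, b, c, y, p, q, r]) := by
    intro p q r
    by_contra! hcon
    have htop := hS.eq_top_of_pillar_subset ha hb hc hab hac hbc hspan hz hy hzy
      (Submodule.span ℝ (Set.range ![a, b, c, y, p, q, r]))
      (Submodule.subset_span ⟨0, rfl⟩) (Submodule.subset_span ⟨1, rfl⟩)
      (Submodule.subset_span ⟨2, rfl⟩) (Submodule.subset_span ⟨3, rfl⟩) hcon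
    have := finrank_le_of_span_eq_top htop
    simp at this
    omega
  -- the span is stable under the symmetry `x ↦ a + b - x` of the pillar, so a vector of the
  -- pillar outside it has product `1` with those inside
  have hout : ∀ p q r x x', InPillar S a b c x' → InPillar S a b c x →
      x ∉ Submodule.span ℝ (Set.range ![a, b, c, y, p, q, r]) →
      x' ∈ Submodule.span ℝ (Set.range ![a, b, c, y, p, q, r]) → ⟪x', x⟫_ℝ = 1 := by
    intro p q r x x' hx' hx hxV hx'V
    rcases hS.inPillar_pair ha hb hab hx' hx with h | h | h
    · exact absurd (h ▸ hx'V) hxV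
    · refine absurd ?_ hxV
      rw [h]
      exact Submodule.sub_mem _ (Submodule.add_mem _ (Submodule.subset_span ⟨0, rfl⟩)
        (Submodule.subset_span ⟨1, rfl⟩)) hx'V
    · exact h
  obtain ⟨z₂, hz₂, hn₂⟩ := hex z z z
  obtain ⟨z₃, hz₃, hn₃⟩ := hex z z₂ z₂
  obtain ⟨z₄, hz₄, hn₄⟩ := hex z z₂ z₃
  have h12 := hout _ _ _ _ z hz hz₂ hn₂ (Submodule.subset_span ⟨4, rfl⟩)
  have h13 := hout _ _ _ _ z hz hz₃ hn₃ (Submodule.subset_span ⟨4, rfl⟩)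
  have h23 := hout _ _ _ _ z₂ hz₂ hz₃ hn₃ (Submodule.subset_span ⟨5, rfl⟩)
  have h14 := hout _ _ _ _ z hz hz₄ hn₄ (Submodule.subset_span ⟨4, rfl⟩)
  have h24 := hout _ _ _ _ z₂ hz₂ hz₄ hn₄ (Submodule.subset_span ⟨5, rfl⟩)
  have h34 := hout _ _ _ _ z₃ hz₃ hz₄ hn₄ (Submodule.subset_span ⟨6, rfl⟩)
  have hp : ∀ i, InPillar S a b c (![z, z₂, z₃, z₄] i) := by
    intro i
    fin_cases i
    exacts [hz, hz₂, hz₃, hz₄]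
  have hp1 : ∀ i j, i ≠ j → ⟪![z, z₂, z₃, z₄] i, ![z, z₂, z₃, z₄] j⟫_ℝ = 1 := by
    intro i j hij
    fin_cases i <;> fin_cases j <;> first
      | exact absurd rfl hij
      | simp only [Fin.zero_eta, Fin.mk_one, Fin.reduceFinMk, Matrix.cons_val]
        first
        | assumption
        | rw [real_inner_comm]; assumption
  have ht : ∀ i, ⟪y, ![z, z₂, z₃, z₄] i⟫_ℝ * ⟪y, ![z, z₂, z₃, z₄] i⟫_ℝ = 1 := by
    intro i
    rw [real_inner_comm]
    rcases InPillar.inner_eq hS (hp i) hy with h | h <;> rw [h] <;> norm_num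
  have hpa : ∀ i, ⟪a, ![z, z₂, z₃, z₄] i⟫_ℝ = 1 := fun i => by
    rw [real_inner_comm, (hp i).left]
  have hpb : ∀ i, ⟪b, ![z, z₂, z₃, z₄] i⟫_ℝ = 1 := fun i => by
    rw [real_inner_comm, (hp i).right]
  have hpc : ∀ i, ⟪c, ![z, z₂, z₃, z₄] i⟫_ℝ = -1 := fun i => by
    rw [real_inner_comm, (hp i).third]
  have hy1' : ⟪a, y⟫_ℝ = 1 := by rw [real_inner_comm, hy.left]
  have hy2' : ⟪c, y⟫_ℝ = 1 := by rw [real_inner_comm, hy.right]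
  -- the components of `y` and of the `z i` orthogonal to `a`, `b`, `c` have norm `2`
  have hd := eq_half_smul_sum (d := y - (1 / 2 : ℝ) • (a + c))
    (e := fun i => ![z, z₂, z₃, z₄] i - (1 / 2 : ℝ) • (a + b))
    (t := fun i => ⟪y, ![z, z₂, z₃, z₄] i⟫_ℝ)
    (by
      simp only [inner_sub_left, inner_sub_right, inner_add_left, inner_add_right,
        real_inner_smul_left, inner_smul_right, hy1', hy2', hy.left, hy.right, haa, hcc, hyy, hac,
        hca]
      norm_num)
    (by
      intro i
      simp only [inner_sub_left, inner_sub_right, inner_add_left, inner_add_right,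
        real_inner_smul_left, inner_smul_right, hpa, hpb, (hp i).left, (hp i).right, haa, hbb,
        hab, hba, hS.inner_self _ (hp i).mem]
      norm_num)
    (by
      intro i j hij
      simp only [inner_sub_left, inner_sub_right, inner_add_left, inner_add_right,
        real_inner_smul_left, inner_smul_right, hpa, hpb, (hp i).left, (hp i).right, haa, hbb,
        hab, hba, hp1 i j hij]
      norm_num)
    (by
      intro i
      simp only [inner_sub_left, inner_sub_right, inner_add_left, inner_add_right,
        real_inner_smul_left, inner_smul_right, hpa, hpc, hy.left, hy.third, haa, hab, hca,
        hcb]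
      norm_num)
    ht
  have ht4 := ht 3
  simp only [Fin.sum_univ_four, Matrix.cons_val] at hd ht4
  -- `hd` is solved for `z₄`
  apply hn₄
  set V := Submodule.span ℝ (Set.range ![a, b, c, y, z, z₂, z₃])
  have hm : ∀ i, ![a, b, c, y, z, z₂, z₃] i ∈ V := fun i => Submodule.subset_span ⟨i, rfl⟩
  have hmab : (1 / 2 : ℝ) • (a + b) ∈ V := V.smul_mem _ (V.add_mem (hm 0) (hm 1))
  have hmac : (1 / 2 : ℝ) • (a + c) ∈ V := V.smul_mem _ (V.add_mem (hm 0) (hm 2))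
  have hz₄eq : z₄ = ⟪y, z₄⟫_ℝ • ((2 : ℝ) • (y - (1 / 2 : ℝ) • (a + c)) -
      ⟪y, z⟫_ℝ • (z - (1 / 2 : ℝ) • (a + b)) - ⟪y, z₂⟫_ℝ • (z₂ - (1 / 2 : ℝ) • (a + b)) -
      ⟪y, z₃⟫_ℝ • (z₃ - (1 / 2 : ℝ) • (a + b))) + (1 / 2 : ℝ) • (a + b) := by
    have h1 : z₄ - (1 / 2 : ℝ) • (a + b) =
        (⟪y, z₄⟫_ℝ * ⟪y, z₄⟫_ℝ) • (z₄ - (1 / 2 : ℝ) • (a + b)) := by rw [ht4, one_smul]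
    rw [← sub_eq_iff_eq_add, h1, hd]
    module
  rw [hz₄eq]
  exact V.add_mem (V.smul_mem _ (V.sub_mem (V.sub_mem (V.sub_mem
    (V.smul_mem _ (V.sub_mem (hm 3) hmac)) (V.smul_mem _ (V.sub_mem (hm 4) hmab)))
    (V.smul_mem _ (V.sub_mem (hm 5) hmab))) (V.smul_mem _ (V.sub_mem (hm 6) hmab)))) hmab

lemma finrank_of_two_pillars [FiniteDimensional ℝ E] (hspan : Submodule.span ℝ S = ⊤) {z y : E}
    (hz : InPillar S a b c z) (hy : InPillar S a c b y) :
    5 ≤ Module.finrank ℝ E ∧ Module.finrank ℝ E ≤ 7 := by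
  obtain ⟨z', hz', hzy⟩ : ∃ z', InPillar S a b c z' ∧ ⟪z', y⟫_ℝ = -1 := by
    rcases InPillar.inner_eq hS hz hy with h | h
    · refine ⟨_, hS.inPillar_reflect ha hb hab hac hbc hz, ?_⟩
      rw [inner_sub_left, inner_add_left, real_inner_comm, hy.left, real_inner_comm, hy.third, h]
      norm_num
    · exact ⟨z, hz, h⟩
  exact ⟨hS.five_le_finrank ha hb hc hab hac hbc hz' hy hzy,
    hS.finrank_le_seven ha hb hc hab hac hbc hspan hz' hy hzy⟩

omit ha hb hc hab hac hbc in
/-- Outside dimensions `5`, `6`, `7`, either the lines are independent or `S` generates a frame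
lattice. -/
theorem ncard_le_or_exists_frame [FiniteDimensional ℝ E] (hspan : Submodule.span ℝ S = ⊤)
    (hdim : ¬(5 ≤ Module.finrank ℝ E ∧ Module.finrank ℝ E ≤ 7)) {X : Set (Submodule ℝ E)}
    (hX : X ⊆ (fun x => Submodule.span ℝ {x}) '' S) :
    X.ncard ≤ Module.finrank ℝ E ∨ ∃ (m : ℕ) (u : E) (w : Fin m → E), 0 < m ∧ IsFrame u w ∧
      Submodule.span ℤ S = frameLattice u w := by
  by_cases hno : ∀ a ∈ S, ∀ b ∈ S, ∀ c ∈ S, ⟪a, b⟫_ℝ = -1 → ⟪a, c⟫_ℝ = -1 → ⟪b, c⟫_ℝ ≠ -1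
  · exact Or.inl (hS.ncard_lines_le_of_no_triple hX hno)
  right
  push Not at hno
  obtain ⟨a, ha, b, hb, c, hc, hab, hac, hbc⟩ := hno
  have hba : ⟪b, a⟫_ℝ = -1 := by rw [real_inner_comm, hab]
  have hca : ⟪c, a⟫_ℝ = -1 := by rw [real_inner_comm, hac]
  have hcb : ⟪c, b⟫_ℝ = -1 := by rw [real_inner_comm, hbc]
  by_cases h1 : ∀ x ∈ S, ⟪x, a⟫_ℝ + ⟪x, b⟫_ℝ ≠ 0
  · exact hS.exists_frame hspan ha hb hab h1
  by_cases h2 : ∀ x ∈ S, ⟪x, a⟫_ℝ + ⟪x, c⟫_ℝ ≠ 0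
  · exact hS.exists_frame hspan ha hc hac h2
  by_cases h3 : ∀ x ∈ S, ⟪x, b⟫_ℝ + ⟪x, c⟫_ℝ ≠ 0
  · exact hS.exists_frame hspan hb hc hbc h3
  -- otherwise at least two of the three pillars are nonempty
  exfalso
  push Not at h1 h2 h3
  obtain ⟨x₁, hx₁, h1⟩ := h1
  obtain ⟨x₂, hx₂, h2⟩ := h2
  obtain ⟨x₃, hx₃, h3⟩ := h3
  have e1 : (∃ y, InPillar S a c b y) ∨ ∃ y, InPillar S b c a y :=
    hS.exists_inPillar_of_inner_eq_zero ha hb hc hab hac hbc hx₁ h1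
  have e2 : (∃ y, InPillar S a b c y) ∨ ∃ y, InPillar S c b a y :=
    hS.exists_inPillar_of_inner_eq_zero ha hc hb hac hab hcb hx₂ h2
  have e3 : (∃ y, InPillar S b a c y) ∨ ∃ y, InPillar S c a b y :=
    hS.exists_inPillar_of_inner_eq_zero hb hc ha hbc hba hca hx₃ h3
  have f1 : ∀ z y, InPillar S a b c z → InPillar S a c b y → False := fun z y hz hy =>
    hdim (hS.finrank_of_two_pillars ha hb hc hab hac hbc hspan hz hy)
  have f2 : ∀ z y, InPillar S b a c z → InPillar S b c a y → False := fun z y hz hy =>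
    hdim (hS.finrank_of_two_pillars hb ha hc hba hbc hac hspan hz hy)
  have f3 : ∀ z y, InPillar S c a b z → InPillar S c b a y → False := fun z y hz hy =>
    hdim (hS.finrank_of_two_pillars hc ha hb hca hcb hab hspan hz hy)
  rcases e1 with ⟨y, hy⟩ | ⟨y, hy⟩
  · rcases e2 with ⟨z, hz⟩ | ⟨z, hz⟩
    · exact f1 z y hz hy
    · exact f3 y z hy.symm hz
  · rcases e3 with ⟨z, hz⟩ | ⟨z, hz⟩
    · exact f2 z y hz hy
    · exact f3 z y hz hy.symm

end IsClosedSystem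

end Pillars

/-! ### Lattices of minimum three with equiangular minimal vectors -/

section Lattice

variable {E : Type*} [NormedAddCommGroup E] [InnerProductSpace ℝ E]

lemma minimalLines_subset (Λ : Submodule ℤ E) :
    minimalLines Λ ⊆ (fun x => Submodule.span ℝ {x}) '' minimalVectors Λ := by
  rintro l ⟨x, hx, rfl⟩
  exact ⟨x, hx, rfl⟩

namespace IsEquiangularMinThree

variable {n : ℕ} {Λ : Submodule ℤ E} (h : IsEquiangularMinThree n Λ)
include h

lemma three_le {x : E} (hx : x ∈ Λ) (hx0 : x ≠ 0) : 3 ≤ ⟪x, x⟫_ℝ :=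
  h.minimum.2 ⟨x, hx, hx0, rfl⟩

lemma mem_minimalVectors_iff {x : E} : x ∈ minimalVectors Λ ↔ x ∈ Λ ∧ ⟪x, x⟫_ℝ = 3 := by
  constructor
  · rintro ⟨hx, hx0, hmin⟩
    obtain ⟨y, hy, hy0, h3⟩ := h.minimum.1
    exact ⟨hx, le_antisymm (h3 ▸ hmin y hy hy0) (h.three_le hx hx0)⟩
  · rintro ⟨hx, h3⟩
    refine ⟨hx, ?_, fun y hy hy0 => h3 ▸ h.three_le hy hy0⟩
    rintro rfl
    simp at h3

lemma minimalVectors_minimalSublattice :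
    minimalVectors (minimalSublattice Λ) = minimalVectors Λ := by
  have hle : minimalSublattice Λ ≤ Λ := Submodule.span_le.2 fun x hx => hx.1
  obtain ⟨v, hv, hv0, hv3⟩ := h.minimum.1
  have hvS : v ∈ minimalVectors Λ := h.mem_minimalVectors_iff.2 ⟨hv, hv3.symm⟩
  ext x
  constructor
  · rintro ⟨hx, hx0, hmin⟩
    rw [h.mem_minimalVectors_iff]
    refine ⟨hle hx, le_antisymm ?_ (h.three_le (hle hx) hx0)⟩
    rw [hv3]
    exact hmin v (Submodule.subset_span hvS) hv0
  · intro hx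
    exact ⟨Submodule.subset_span hx, hx.2.1, fun y hy hy0 => hx.2.2 y (hle hy) hy0⟩

lemma minimalLines_minimalSublattice :
    minimalLines (minimalSublattice Λ) = minimalLines Λ := by
  rw [minimalLines, minimalLines, h.minimalVectors_minimalSublattice]

lemma finiteDimensional (hn : 0 < n) : FiniteDimensional ℝ E :=
  Module.finite_of_finrank_pos (by rw [h.dim]; exact hn)

lemma span_minimalVectors (hn : 0 < n) : Submodule.span ℝ (minimalVectors Λ) = ⊤ := by
  have := h.finiteDimensional hn
  rw [eq_top_iff, ← Submodule.eq_top_of_finrank_eq (h.rank.trans h.dim.symm)]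
  apply sSup_le
  rintro l ⟨x, hx, rfl⟩
  exact Submodule.span_mono (by simpa using hx)

lemma inner_cases {x y : E} (hx : x ∈ minimalVectors Λ) (hy : y ∈ minimalVectors Λ) :
    y = x ∨ y = -x ∨ ⟪x, y⟫_ℝ = 0 ∨ ⟪x, y⟫_ℝ = 1 ∨ ⟪x, y⟫_ℝ = -1 := by
  obtain ⟨hxm, hxx⟩ := h.mem_minimalVectors_iff.1 hx
  obtain ⟨hym, hyy⟩ := h.mem_minimalVectors_iff.1 hy
  by_cases h1 : y = x
  · exact Or.inl h1
  by_cases h2 : y = -x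
  · exact Or.inr (Or.inl h2)
  have h3 := h.three_le (sub_mem hym hxm) (sub_ne_zero.2 h1)
  have h4 := h.three_le (add_mem hym hxm) (fun h0 => h2 (eq_neg_of_add_eq_zero_left h0))
  obtain ⟨k, hk⟩ := h.integral x hxm y hym
  have hk' : ⟪y, x⟫_ℝ = k := by rw [real_inner_comm, hk]
  simp only [inner_sub_left, inner_sub_right, inner_add_left, inner_add_right, hxx, hyy, hk,
    hk'] at h3 h4
  -- `3 ≤ 6 ± 2 k`
  have hk1 : (k : ℝ) < 2 := by linarith
  have hk2 : (-2 : ℝ) < k := by linarith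
  have hk3 : k < 2 := by exact_mod_cast hk1
  have hk4 : -2 < k := by exact_mod_cast hk2
  rw [hk]
  rcases (show k = 0 ∨ k = 1 ∨ k = -1 by omega) with rfl | rfl | rfl <;> simp

lemma span_singleton_ne {x y : E} (hx : x ∈ minimalVectors Λ) (hy : y ∈ minimalVectors Λ)
    (h1 : y ≠ x) (h2 : y ≠ -x) : Submodule.span ℝ {x} ≠ Submodule.span ℝ {y} := by
  intro heq
  have hy' : y ∈ Submodule.span ℝ {x} := heq ▸ Submodule.mem_span_singleton_self y
  obtain ⟨c, rfl⟩ := Submodule.mem_span_singleton.1 hy'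
  have hxx := (h.mem_minimalVectors_iff.1 hx).2
  have hyy := (h.mem_minimalVectors_iff.1 hy).2
  rw [real_inner_smul_left, inner_smul_right, hxx] at hyy
  have hc : c * c = 1 := by linarith
  rcases mul_self_eq_one_iff.1 hc with rfl | rfl
  · exact h1 (one_smul _ _)
  · exact h2 (neg_one_smul _ _)

/-- Two minimal vectors on distinct lines that are not orthogonal force the common angle
to be `arccos (1 / 3)`. -/
lemma isClosedSystem {x₀ y₀ : E} (hx₀ : x₀ ∈ minimalVectors Λ) (hy₀ : y₀ ∈ minimalVectors Λ)
    (h1 : y₀ ≠ x₀) (h2 : y₀ ≠ -x₀) (h0 : ⟪x₀, y₀⟫_ℝ ≠ 0) :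
    IsClosedSystem (minimalVectors Λ) := by
  obtain ⟨-, θ, -, hθ⟩ := h.equiangular
  refine ⟨fun x hx => (h.mem_minimalVectors_iff.1 hx).2, fun x hx => ?_, fun x hx y hy => ?_,
    fun x hx y hy z hz hxy hxz hyz => ?_⟩
  · rw [h.mem_minimalVectors_iff] at hx ⊢
    exact ⟨neg_mem hx.1, by rw [inner_neg_neg, hx.2]⟩
  · by_cases hxy1 : y = x
    · exact Or.inl hxy1
    by_cases hxy2 : y = -x
    · exact Or.inr (Or.inl hxy2)
    rcases h.inner_cases hx hy with hc | hc | hc | hc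
    · exact Or.inl hc
    · exact Or.inr (Or.inl hc)
    · exfalso
      have e1 := hθ _ ⟨x, hx, rfl⟩ _ ⟨y, hy, rfl⟩ (h.span_singleton_ne hx hy hxy1 hxy2)
        x (Submodule.mem_span_singleton_self x) y (Submodule.mem_span_singleton_self y)
      have e2 := hθ _ ⟨x₀, hx₀, rfl⟩ _ ⟨y₀, hy₀, rfl⟩ (h.span_singleton_ne hx₀ hy₀ h1 h2)
        x₀ (Submodule.mem_span_singleton_self x₀) y₀ (Submodule.mem_span_singleton_self y₀)
      have hnx : ‖x‖ ≠ 0 := norm_ne_zero_iff.2 hx.2.1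
      have hny : ‖y‖ ≠ 0 := norm_ne_zero_iff.2 hy.2.1
      rw [hc, abs_zero, eq_comm, mul_eq_zero, or_iff_left (mul_ne_zero hnx hny)] at e1
      rw [e1, zero_mul, abs_eq_zero] at e2
      exact h0 e2
    · exact Or.inr (Or.inr hc)
  · rw [h.mem_minimalVectors_iff] at *
    refine ⟨add_mem (add_mem hx.1 hy.1) hz.1, ?_⟩
    simp only [inner_add_left, inner_add_right, hx.2, hy.2, hz.2, hxy, hxz, hyz,
      real_inner_comm x y, real_inner_comm x z, real_inner_comm y z]
    norm_num

/-- If all minimal vectors on distinct lines are orthogonal, there are at most `n` lines. -/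
lemma ncard_le_of_orthogonal (hn : 0 < n)
    (h0 : ∀ x ∈ minimalVectors Λ, ∀ y ∈ minimalVectors Λ, y ≠ x → y ≠ -x → ⟪x, y⟫_ℝ = 0) :
    (minimalLines Λ).ncard ≤ n := by
  have := h.finiteDimensional hn
  have hex : ∀ l : minimalLines Λ, ∃ x ∈ minimalVectors Λ,
      (l : Submodule ℝ E) = Submodule.span ℝ {x} :=
    fun l => l.2
  choose f hf hfl using hex
  rw [← h.dim]
  refine ncard_lines_le_finrank (R := Set.range f) (k := 0) le_rfl (by norm_num) ?_ ?_ ?_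
  · rintro _ ⟨l, rfl⟩
    exact (h.mem_minimalVectors_iff.1 (hf l)).2
  · rintro _ ⟨l, rfl⟩ _ ⟨l', rfl⟩ hne
    refine h0 _ (hf l) _ (hf l') hne.symm fun heq => hne ?_
    have : l = l' := by
      apply Subtype.ext
      rw [hfl l, hfl l', heq, ← Set.neg_singleton, Submodule.span_neg]
    rw [this]
  · intro l hl
    exact ⟨f ⟨l, hl⟩, ⟨_, rfl⟩, (hfl ⟨l, hl⟩).symm⟩

/-- Outside dimensions `5`, `6`, `7`, either there are at most `n` lines, or the minimal vectors
generate a frame lattice. -/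
theorem ncard_le_or_exists_frame (hn : 0 < n) (hdim : ¬(5 ≤ n ∧ n ≤ 7)) :
    (minimalLines Λ).ncard ≤ n ∨ ∃ (m : ℕ) (u : E) (w : Fin m → E), 0 < m ∧ IsFrame u w ∧
      minimalSublattice Λ = frameLattice u w := by
  have := h.finiteDimensional hn
  by_cases h0 : ∀ x ∈ minimalVectors Λ, ∀ y ∈ minimalVectors Λ, y ≠ x → y ≠ -x → ⟪x, y⟫_ℝ = 0
  · exact Or.inl (h.ncard_le_of_orthogonal hn h0)
  push Not at h0
  obtain ⟨x, hx, y, hy, h1, h2, h3⟩ := h0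
  rw [← h.dim] at hdim ⊢
  exact (h.isClosedSystem hx hy h1 h2 h3).ncard_le_or_exists_frame (h.span_minimalVectors hn)
    hdim (minimalLines_subset Λ)

end IsEquiangularMinThree

end Lattice

end EquiLat

end

theorem theorem2p5 (n : ℕ) (hn : 2 ≤ n) (h5 : n ≠ 5) (h6 : n ≠ 6) (h7 : n ≠ 7)
    {E : Type*} [NormedAddCommGroup E] [InnerProductSpace ℝ E]
    (hE : Module.finrank ℝ E = n) :
    -- the maximal number of lines is `2 (n - 1)`
    IsGreatest {s : ℕ | ∃ Λ : Submodule ℤ E,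
      EquiLat.IsEquiangularMinThree n Λ ∧ s = (EquiLat.minimalLines Λ).ncard} (2 * (n - 1)) ∧
    -- the projection of `D_{n+1}` is such a lattice, generated by its minimal vectors,
    -- and attains the maximum
    (EquiLat.IsEquiangularMinThree n (EquiLat.projectedD n) ∧
      EquiLat.minimalSublattice (EquiLat.projectedD n) = EquiLat.projectedD n ∧
      (EquiLat.minimalLines (EquiLat.projectedD n)).ncard = 2 * (n - 1)) ∧
    -- uniqueness for `n ≠ 2`
    (n ≠ 2 → ∀ Λ : Submodule ℤ E, EquiLat.IsEquiangularMinThree n Λ →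
      (EquiLat.minimalLines Λ).ncard = 2 * (n - 1) →
        EquiLat.Isometric (EquiLat.minimalSublattice Λ) (EquiLat.projectedD n) ∧
        (EquiLat.minimalSublattice Λ = Λ → EquiLat.Isometric Λ (EquiLat.projectedD n))) := by
  obtain ⟨m, rfl⟩ : ∃ m, n = m + 1 := ⟨n - 1, by omega⟩
  have hne : Nonempty (Fin m) := ⟨⟨0, by omega⟩⟩
  have hdim : ¬(5 ≤ m + 1 ∧ m + 1 ≤ 7) := by omega
  rw [EquiLat.projectedD_eq_frameLattice, Nat.add_sub_cancel]
  have hP := EquiLat.isFrame_projected m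
  refine ⟨⟨?_, ?_⟩, ⟨?_, hP.minimalSublattice_eq, ?_⟩, ?_⟩
  · obtain ⟨u, w, hf⟩ := EquiLat.exists_isFrame m hE
    refine ⟨EquiLat.frameLattice u w, ?_, ?_⟩
    · simpa using hf.isEquiangularMinThree
    · simpa using hf.ncard_minimalLines.symm
  · rintro _ ⟨Λ, hΛ, rfl⟩
    rcases hΛ.ncard_le_or_exists_frame (by omega) hdim with h | ⟨k, u, w, hk, hf, hlat⟩
    · omega
    · have : Nonempty (Fin k) := ⟨⟨0, hk⟩⟩
      have hc := hf.ncard_minimalLines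
      have hr := hf.finrank_eq
      rw [← hlat, hΛ.minimalLines_minimalSublattice] at hc
      simp only [Fintype.card_fin] at hc hr
      omega
  · simpa using hP.isEquiangularMinThree
  · simpa using hP.ncard_minimalLines
  · intro h2 Λ hΛ hcard
    rcases hΛ.ncard_le_or_exists_frame (by omega) hdim with h | ⟨k, u, w, hk, hf, hlat⟩
    · omega
    · have hr := hf.finrank_eq
      rw [Fintype.card_fin, hE] at hr
      have hiso := hf.isometric hP (finCongr (show k = m by omega))
      rw [← hlat] at hiso
      exact ⟨hiso, fun heq => heq ▸ hiso⟩
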